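/- Let $N\in\mathbb{N}\cup\{\infty\}$, and let $A$, $B$ be $N\times N$ matrices with integer entries, row-finite ($\sum_j|A_{i,j}|<\infty$ and $\sum_j|B_{i,j}|<\infty$ for every $i$) and without identically zero rows, with $A_{i,j}\ge 0$ for all $i,j$. Let $E$ be the directed graph with vertices $1,\dots,N$ and edges $e_{i,j,n}$, $0\le n<A_{i,j}$, from $s(e_{i,j,n})=i$ to $r(e_{i,j,n})=j$. For $m\in\mathbb{Z}$ write $mB_{i,j}+n=kA_{i,j}+l$ with $k,l\in\mathbb{Z}$, $0\le l<A_{i,j}$, and put $\kappa_m(e_{i,j,n})=e_{i,j,l}$, $\varphi(m,e_{i,j,n})=k$. Assume that the pair $A,B$ is pseudo free: if $m\in\mathbb{Z}$ and $e$ is an edge with $\kappa_m(e)=e$ and $\varphi(m,e)=0$, then $m=0$. Let $\mathbb{Z}$ act on the space $E^\infty$ of infinite paths $y_1y_2\cdots$ (edges $y_n$ with $r(y_n)=s(y_{n+1})$; topology induced by the product of discrete spaces) by $\kappa_m(y_1y_2\cdots)=\kappa_{m_1}(y_1)\kappa_{m_2}(y_2)\cdots$, where $m_1=m$, $m_{n+1}=\varphi(m_n,y_n)$.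 Let $\mathcal{G}_{A,B}$ be the groupoid of equivalence classes $[\alpha,m,\beta;x]$ of quadruples in which $\alpha,\beta$ are finite paths (vertices being the paths of length $0$) with $r(\alpha)=r(\beta)$, $m\in\mathbb{Z}$, and $x\in Z(\beta)$, the set of infinite paths starting with $\beta$, for the equivalence relation generated by $(\alpha,m,\beta;x)\sim(\alpha\kappa_m(\gamma),\varphi(m,\gamma),\beta\gamma;x)$ whenever $\gamma$ is an edge and $x=\beta\gamma y$. Its unit space is $E^\infty$, with $s[\alpha,m,\beta;\beta y]=\beta y$ and $r[\alpha,m,\beta;\beta y]=\alpha\kappa_m(y)$; the product is $[\alpha,m',\beta;\beta\kappa_m(y)]\cdot[\beta,m,\gamma;\gamma y]=[\alpha,m'+m,\gamma;\gamma y]$; the inverse is $[\alpha,m,\beta;\beta y]^{-1}=[\beta,-m,\alpha;\alpha\kappa_m(y)]$; and the sets $\{[\alpha,m,\beta;x]:x\in Z(\beta)\}$ form a basis of its topology, for which it is a Hausdorff étale groupoid. Let $\rho:\mathcal{G}_{A,B}\to\mathbb{Z}$ be the homomorphism $[\alpha,m,\beta;x]\mapsto|\alpha|-|\beta|$, where $|\cdot|$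 is the length of a path, and let $\mathcal{H}_{A,B}=\ker\rho$. For a Hausdorff étale groupoid $\mathcal{G}$ let $\mathcal{G}^{(n)}$ be the space of composable strings of $n$ arrows ($\mathcal{G}^{(0)}$ being the unit space), and let $H_n(\mathcal{G})$ be the $n$-th homology group of the chain complex of the groups $C_c(\mathcal{G}^{(n)},\mathbb{Z})$ of continuous compactly supported functions with the boundary maps $\delta_1=s_*-r_*$ and $\delta_n=\sum_{i=0}^n(-1)^i(d_i)_*$ for $n\ge 2$. Here $d_0$ and $d_n$ delete the first and the last entry of $(g_1,\dots,g_n)$, $d_i$ replaces $g_i,g_{i+1}$ by $g_ig_{i+1}$ for $1\le i\le n-1$, and $\pi_*(f)(y)=\sum_{\pi(x)=y}f(x)$ for a local homeomorphism $\pi$. Then $H_i(\mathcal{H}_{A,B})=0$ for all $i\ge 2$. -/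

import Mathlib

open scoped CompactlySupported

universe u

/-! ### Push-forward along local homeomorphisms -/

section Pushforward

variable {X Y Z : Type*} [TopologicalSpace X] [TopologicalSpace Y] [TopologicalSpace Z]

theorem isLocalHomeomorph_of_locallyInjective_of_isOpenMap {f : X → Y} (hc : Continuous f)
    (ho : IsOpenMap f) (hi : ∀ x, ∃ U : Set X, IsOpen U ∧ x ∈ U ∧ Set.InjOn f U) :
    IsLocalHomeomorph f := by
  rw [isLocalHomeomorph_iff_isOpenEmbedding_restrict]
  intro x
  obtain ⟨U, hU, hx, hinj⟩ := hi x
  refine ⟨U, hU.mem_nhds hx, .of_continuous_injective_isOpenMap ?_ ?_ ?_⟩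
  · exact hc.comp continuous_subtype_val
  · exact hinj.injective
  · exact ho.domRestrict hU

/-- The base change of a local homeomorphism is a local homeomorphism. -/
theorem IsLocalHomeomorph.of_isPullback {W : Type*} [TopologicalSpace W] {f : Y → Z} {b : X → Z}
    {q : W → X} {p : W → Y} (hf : IsLocalHomeomorph f) (hb : Continuous b)
    (hW : Topology.IsEmbedding fun w => (q w, p w)) (hcomm : ∀ w, b (q w) = f (p w))
    (hsurj : ∀ x y, b x = f y → ∃ w, q w = x ∧ p w = y) : IsLocalHomeomorph q := by
  have hq : Continuous q := continuous_fst.comp hW.continuous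
  have hp : Continuous p := continuous_snd.comp hW.continuous
  refine isLocalHomeomorph_of_locallyInjective_of_isOpenMap hq ?_ ?_
  · rw [isOpenMap_iff_nhds_le]
    intro w s hs
    rw [Filter.mem_map, hW.isInducing.nhds_eq_comap, Filter.mem_comap] at hs
    obtain ⟨t, ht, hts⟩ := hs
    obtain ⟨e, he, hfe⟩ := hf (p w)
    have hx : b (q w) ∈ e.target := by rw [hcomm, hfe]; exact e.map_source he
    have h1 : ∀ᶠ x in nhds (q w), b x ∈ e.target :=
      hb.continuousAt.eventually (e.open_target.mem_nhds hx)
    have h0 : e.symm (b (q w)) = p w := by rw [hcomm, hfe, e.left_inv he]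
    have hcont : ContinuousAt (fun x => (x, e.symm (b x))) (q w) :=
      continuousAt_id.prodMk ((e.continuousAt_symm hx).comp hb.continuousAt)
    have h2 : ∀ᶠ x in nhds (q w), (x, e.symm (b x)) ∈ t := by
      apply hcont.eventually
      change t ∈ nhds (q w, e.symm (b (q w)))
      rwa [h0]
    filter_upwards [h1, h2] with x hx1 hx2
    obtain ⟨w', hw1, hw2⟩ := hsurj x (e.symm (b x)) (by rw [hfe, e.right_inv hx1])
    have : w' ∈ q ⁻¹' s := hts (by simpa only [Set.mem_preimage, hw1, hw2] using hx2)
    rwa [← hw1]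
  · intro w
    obtain ⟨e, he, hfe⟩ := hf (p w)
    refine ⟨p ⁻¹' e.source, e.open_source.preimage hp, he, ?_⟩
    intro a ha c hc hac
    apply hW.injective
    refine Prod.ext hac (e.injOn ha hc ?_)
    rw [← hfe, ← hcomm, hac, hcomm]

theorem finite_fiber_inter_support [T2Space X] [T1Space Y] {π : X → Y} (hπ : IsLocalHomeomorph π)
    (f : C_c(X, ℤ)) (y : Y) : (π ⁻¹' {y} ∩ tsupport f).Finite := by
  have hK : IsCompact (π ⁻¹' {y} ∩ tsupport f) :=
    f.hasCompactSupport.isCompact.inter_left (isClosed_singleton.preimage hπ.continuous)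
  refine hK.finite ?_
  refine IsDiscrete.mono (s := π ⁻¹' {y}) ?_ Set.inter_subset_left
  exact (hπ.isLocalHomeomorphOn (s := _)).isDiscrete_of_image
    (Set.Subsingleton.isDiscrete (by rintro _ ⟨a, ha, rfl⟩ _ ⟨b, hb, rfl⟩; exact ha.trans hb.symm))

theorem finite_fiber_support [T2Space X] [T1Space Y] {π : X → Y} (hπ : IsLocalHomeomorph π)
    (f : C_c(X, ℤ)) (y : Y) : (π ⁻¹' {y} ∩ Function.support f).Finite :=
  (finite_fiber_inter_support hπ f y).subset
    (Set.inter_subset_inter_right _ (subset_tsupport f))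

theorem continuous_fiberSum [T2Space X] [T2Space Y] {π : X → Y} (hπ : IsLocalHomeomorph π)
    (f : C_c(X, ℤ)) : Continuous fun y => ∑ᶠ x ∈ π ⁻¹' {y}, f x := by
  classical
  rw [continuous_iff_continuousAt]
  intro y
  have hfin := finite_fiber_inter_support hπ f y
  obtain ⟨U, hU, hdisj⟩ := hfin.t2_separation
  -- shrink the separating neighbourhoods
  have hV : ∀ x, ∃ V : Set X, IsOpen V ∧ x ∈ V ∧ V ⊆ U x ∧ Set.InjOn π V ∧ ∀ z ∈ V, f z = f x := by
    intro x
    obtain ⟨e, he, hfe⟩ := hπ x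
    refine ⟨U x ∩ e.source ∩ f ⁻¹' {f x}, ((hU x).2.inter e.open_source).inter
      ((isOpen_discrete _).preimage f.continuous), ⟨⟨(hU x).1, he⟩, rfl⟩, ?_, ?_, ?_⟩
    · exact fun z hz => hz.1.1
    · rw [hfe]; exact e.injOn.mono fun z hz => hz.1.2
    · exact fun z hz => hz.2
  choose V hVo hxV hVU hVinj hVf using hV
  set F := hfin.toFinset with hF
  have hrest : IsClosed (π '' (tsupport f \ ⋃ x ∈ F, V x)) :=
    ((f.hasCompactSupport.isCompact.diff (isOpen_biUnion fun x _ => hVo x)).image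
      hπ.continuous).isClosed
  have h1 : ∀ᶠ z in nhds y, z ∉ π '' (tsupport f \ ⋃ x ∈ F, V x) := by
    refine hrest.isOpen_compl.mem_nhds ?_
    rintro ⟨x, ⟨hx1, hx2⟩, hxy⟩
    apply hx2
    simp only [Set.mem_iUnion]
    exact ⟨x, by simp [hF, hxy, hx1], hxV x⟩
  have h2 : ∀ᶠ z in nhds y, ∀ x ∈ F, z ∈ π '' V x := by
    rw [Filter.eventually_all_finset]
    intro x hx
    have hxy : π x = y := by
      have := (Set.Finite.mem_toFinset hfin).1 hx
      exact this.1
    exact (hπ.isOpenMap _ (hVo x)).mem_nhds ⟨x, hxV x, hxy⟩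
  have key : ∀ z, z ∉ π '' (tsupport f \ ⋃ x ∈ F, V x) → (∀ x ∈ F, z ∈ π '' V x) →
      ∑ᶠ x ∈ π ⁻¹' {z}, f x = ∑ x ∈ F, f x := by
    intro z hz1 hz2
    choose g hgV hgπ using hz2
    have hs : π ⁻¹' {z} ∩ Function.support f ⊆ (F.attach.image fun x => g x.1 x.2 : Finset X) := by
      rintro w ⟨hw1, hw2⟩
      have hw3 : w ∈ ⋃ x ∈ F, V x := by
        by_contra hcon
        exact hz1 ⟨w, ⟨subset_tsupport f hw2, hcon⟩, hw1⟩
      simp only [Set.mem_iUnion] at hw3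
      obtain ⟨x, hx, hwx⟩ := hw3
      have : g x hx = w := hVinj x (hgV x hx) hwx ((hgπ x hx).trans hw1.symm)
      simp only [Finset.coe_image, Set.mem_image, Finset.mem_coe, Finset.mem_attach, true_and,
        Subtype.exists]
      exact ⟨x, hx, this⟩
    have hs' : ((F.attach.image fun x => g x.1 x.2 : Finset X) : Set X) ⊆ π ⁻¹' {z} := by
      intro w hw
      simp only [Finset.coe_image, Set.mem_image, Finset.mem_coe, Finset.mem_attach, true_and,
        Subtype.exists] at hw
      obtain ⟨x, hx, rfl⟩ := hw
      exact hgπ x hx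
    rw [finsum_mem_eq_sum_of_subset f hs hs', Finset.sum_image, ← Finset.sum_attach F]
    · exact Finset.sum_congr rfl fun x _ => hVf x.1 _ (hgV x.1 x.2)
    · rintro ⟨a, ha⟩ - ⟨b, hb⟩ - hab
      by_contra hne
      have hne' : a ≠ b := fun h => hne (Subtype.ext h)
      have hd := hdisj ((Set.Finite.mem_toFinset hfin).1 ha) ((Set.Finite.mem_toFinset hfin).1 hb)
        hne'
      refine Set.disjoint_left.1 hd (hVU a (hgV a ha)) ?_
      have : g a ha = g b hb := hab
      rw [this]
      exact hVU b (hgV b hb)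
  have h3 : ∀ᶠ z in nhds y, ∑ᶠ x ∈ π ⁻¹' {z}, f x = ∑ x ∈ F, f x := by
    filter_upwards [h1, h2] with z hz1 hz2 using key z hz1 hz2
  refine ContinuousAt.congr (f := fun _ => ∑ x ∈ F, f x) continuousAt_const ?_
  filter_upwards [h3] with z hz using hz.symm

/-- The push-forward `π_* f (y) = ∑_{π x = y} f x` along a local homeomorphism of Hausdorff
spaces. For `f` in `C_c(X, ℤ)` each of these sums has only finitely many nonzero terms. -/
noncomputable def pushforward [T2Space X] [T2Space Y] (π : X → Y) (hπ : IsLocalHomeomorph π) :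
    C_c(X, ℤ) →+ C_c(Y, ℤ) where
  toFun f :=
    { toFun := fun y => ∑ᶠ x ∈ π ⁻¹' {y}, f x
      continuous_toFun := continuous_fiberSum hπ f
      hasCompactSupport' := by
        refine HasCompactSupport.intro (f.hasCompactSupport.isCompact.image hπ.continuous) ?_
        intro y hy
        refine finsum_mem_eq_zero_of_forall_eq_zero fun x hx => ?_
        by_contra hne
        exact hy ⟨x, subset_tsupport f hne, hx⟩ }
  map_zero' := by
    ext y
    simp
  map_add' f g := by
    ext y
    exact finsum_mem_add_distrib' (finite_fiber_support hπ f y) (finite_fiber_support hπ g y)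

theorem pushforward_apply [T2Space X] [T2Space Y] {π : X → Y} (hπ : IsLocalHomeomorph π)
    (f : C_c(X, ℤ)) (y : Y) : pushforward π hπ f y = ∑ᶠ x ∈ π ⁻¹' {y}, f x := rfl

theorem pushforward_comp [T2Space X] [T2Space Y] [T2Space Z] {π : X → Y} {τ : Y → Z}
    (hπ : IsLocalHomeomorph π) (hτ : IsLocalHomeomorph τ) (f : C_c(X, ℤ)) :
    pushforward τ hτ (pushforward π hπ f) = pushforward (τ ∘ π) (hτ.comp hπ) f := by
  classical
  ext z
  simp only [pushforward_apply]
  have hfin : ((τ ∘ π) ⁻¹' {z} ∩ Function.support f).Finite :=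
    finite_fiber_support (hτ.comp hπ) f z
  set T := hfin.toFinset with hT
  have hmem : ∀ x, x ∈ T ↔ τ (π x) = z ∧ f x ≠ 0 := fun x => by simp [hT]
  have h1 : ∀ y ∈ τ ⁻¹' {z}, ∑ᶠ x ∈ π ⁻¹' {y}, f x = ∑ x ∈ T with π x = y, f x := by
    intro y hy
    refine finsum_mem_eq_sum_of_subset f ?_ ?_
    · rintro x ⟨hx1, hx2⟩
      rw [Finset.mem_coe, Finset.mem_filter, hmem]
      have hx1' : π x = y := hx1
      exact ⟨⟨by rw [hx1']; exact hy, hx2⟩, hx1⟩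
    · intro x hx
      exact (Finset.mem_filter.1 hx).2
  rw [finsum_mem_congr rfl h1, finsum_mem_eq_sum_of_subset (t := T.image π),
    Finset.sum_fiberwise_of_maps_to (fun x hx => Finset.mem_image_of_mem π hx)]
  · refine (finsum_mem_eq_sum_of_subset f (fun x hx => ?_) fun x hx => ?_).symm
    · exact (hmem x).2 hx
    · exact ((hmem x).1 hx).1
  · rintro y ⟨-, hy⟩
    obtain ⟨x, hx, -⟩ := Finset.exists_ne_zero_of_sum_ne_zero hy
    obtain ⟨hx1, hx2⟩ := Finset.mem_filter.1 hx
    rw [Finset.mem_coe, ← hx2]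
    exact Finset.mem_image_of_mem π hx1
  · intro y hy
    obtain ⟨x, hx, rfl⟩ := Finset.mem_image.1 hy
    exact ((hmem x).1 hx).1

end Pushforward

/-! ### Étale groupoids and their homology -/

/-- A Hausdorff étale groupoid: a topological groupoid with space of arrows `Arr` and space of
units `Obj` (embedded in `Arr` by `one`) whose range map is a local homeomorphism.
`mul g h` is the product `g h`; it is meaningful only if `src g = rng h`. -/
structure EtaleGroupoid where
  Obj : Type u
  Arr : Type u
  [topObj : TopologicalSpace Obj]
  [topArr : TopologicalSpace Arr]
  [t2Obj : T2Space Obj]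
  [t2Arr : T2Space Arr]
  src : Arr → Obj
  rng : Arr → Obj
  one : Obj → Arr
  inv : Arr → Arr
  mul : Arr → Arr → Arr
  src_one : ∀ x, src (one x) = x
  rng_one : ∀ x, rng (one x) = x
  src_inv : ∀ g, src (inv g) = rng g
  rng_inv : ∀ g, rng (inv g) = src g
  src_mul : ∀ g h, src g = rng h → src (mul g h) = src h
  rng_mul : ∀ g h, src g = rng h → rng (mul g h) = rng g
  mul_assoc : ∀ g h k, src g = rng h → src h = rng k → mul (mul g h) k = mul g (mul h k)
  one_mul : ∀ g, mul (one (rng g)) g = g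
  mul_one : ∀ g, mul g (one (src g)) = g
  inv_mul : ∀ g, mul (inv g) g = one (src g)
  mul_inv : ∀ g, mul g (inv g) = one (rng g)
  continuous_one : Continuous one
  continuous_inv : Continuous inv
  continuous_mul : Continuous fun p : {p : Arr × Arr // src p.1 = rng p.2} => mul p.1.1 p.1.2
  isLocalHomeomorph_src : IsLocalHomeomorph src
  isLocalHomeomorph_rng : IsLocalHomeomorph rng

namespace EtaleGroupoid

instance (G : EtaleGroupoid.{u}) : TopologicalSpace G.Obj := G.topObj
instance (G : EtaleGroupoid.{u}) : TopologicalSpace G.Arr := G.topArr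
instance (G : EtaleGroupoid.{u}) : T2Space G.Obj := G.t2Obj
instance (G : EtaleGroupoid.{u}) : T2Space G.Arr := G.t2Arr

variable (G : EtaleGroupoid.{u})

/-- The space `G^(n)` of composable strings `(g_1, …, g_n)`, with `G^(0)` the unit space. -/
def Strings : ℕ → Type u
  | 0 => G.Obj
  | n + 1 => {g : Fin (n + 1) → G.Arr // ∀ i : Fin n, G.src (g i.castSucc) = G.rng (g i.succ)}

instance : (n : ℕ) → TopologicalSpace (G.Strings n)
  | 0 => inferInstanceAs (TopologicalSpace G.Obj)
  | n + 1 => inferInstanceAs (TopologicalSpace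
      {g : Fin (n + 1) → G.Arr // ∀ i : Fin n, G.src (g i.castSucc) = G.rng (g i.succ)})

instance : (n : ℕ) → T2Space (G.Strings n)
  | 0 => inferInstanceAs (T2Space G.Obj)
  | n + 1 => inferInstanceAs (T2Space
      {g : Fin (n + 1) → G.Arr // ∀ i : Fin n, G.src (g i.castSucc) = G.rng (g i.succ)})

variable {G}

theorem composable_tail {n : ℕ} {g : Fin (n + 2) → G.Arr}
    (hg : ∀ i : Fin (n + 1), G.src (g i.castSucc) = G.rng (g i.succ)) (i : Fin n) :
    G.src (g i.castSucc.succ) = G.rng (g i.succ.succ) := by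
  simpa using hg i.succ

theorem composable_contractNth {n : ℕ} {g : Fin (n + 2) → G.Arr}
    (hg : ∀ i : Fin (n + 1), G.src (g i.castSucc) = G.rng (g i.succ)) (j : Fin (n + 2))
    (i : Fin n) : G.src (j.contractNth G.mul g i.castSucc) =
      G.rng (j.contractNth G.mul g i.succ) := by
  have h1 : G.src (g i.castSucc.castSucc) = G.rng (g i.castSucc.succ) := hg i.castSucc
  have h2 : G.src (g i.castSucc.succ) = G.rng (g i.succ.succ) := composable_tail hg i
  unfold Fin.contractNth
  simp only [Fin.val_castSucc, Fin.val_succ]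
  have h3 : i.succ.castSucc = i.castSucc.succ := rfl
  split_ifs <;> first | omega | skip
  · rw [h3, h1]
  · rw [h3, h1, G.rng_mul _ _ h2]
  · rw [G.src_mul _ _ h1, h2]

variable (G)

/-- The face maps `d_i : G^(n+1) → G^(n)`. On `G^(1)` they are `d_0 = s` and `d_1 = r`; on longer
strings `d_0` and the last one drop the first and the last entry, and for `i` in between
`d_i (g_1, …) = (g_1, …, g_i g_{i+1}, …)`. (`Fin.contractNth j` multiplies the entries number `j`
and `j + 1`, counted from `0`, and drops the last entry if `j` is the last index.) -/
def face : (n : ℕ) → Fin (n + 2) → G.Strings (n + 1) → G.Strings n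
  | 0, i, g => Fin.cases (G.src (g.1 0)) (fun _ => G.rng (g.1 0)) i
  | _ + 1, i, g => Fin.cases
      (⟨fun k => g.1 k.succ, composable_tail g.2⟩)
      (fun j => ⟨j.contractNth G.mul g.1, composable_contractNth g.2 j⟩) i

/-- The range of the first entry of a string. -/
def firstUnit : (n : ℕ) → G.Strings n → G.Obj
  | 0, x => x
  | _ + 1, g => G.rng (g.1 0)

/-- The source of the last entry of a string. -/
def lastUnit : (n : ℕ) → G.Strings n → G.Obj
  | 0, x => x
  | n + 1, g => G.src (g.1 (Fin.last n))

theorem continuous_firstUnit : (n : ℕ) → Continuous (G.firstUnit n)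
  | 0 => continuous_id
  | _ + 1 => G.isLocalHomeomorph_rng.continuous.comp
      ((continuous_apply 0).comp continuous_subtype_val)

theorem continuous_contractNth {n : ℕ} (j : Fin (n + 2)) (k : Fin (n + 1)) :
    Continuous fun g : G.Strings (n + 2) => j.contractNth G.mul g.1 k := by
  have hk : ∀ i, Continuous fun g : G.Strings (n + 2) => g.1 i := fun i =>
    (continuous_apply i).comp continuous_subtype_val
  unfold Fin.contractNth
  split_ifs
  · exact hk _
  · exact G.continuous_mul.comp
      (Continuous.subtype_mk ((hk k.castSucc).prodMk (hk k.succ)) fun g => g.2 k)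
  · exact hk _

theorem continuous_face (n : ℕ) (i : Fin (n + 2)) : Continuous (G.face n i) := by
  have hk : ∀ {n} i, Continuous fun g : G.Strings (n + 1) => g.1 i := fun i =>
    (continuous_apply i).comp continuous_subtype_val
  cases n with
  | zero =>
    induction i using Fin.cases with
    | zero => exact G.isLocalHomeomorph_src.continuous.comp (hk 0)
    | succ j => exact G.isLocalHomeomorph_rng.continuous.comp (hk 0)
  | succ n =>
    induction i using Fin.cases with
    | zero => exact Continuous.subtype_mk (continuous_pi fun k => hk _) _
    | succ j => exact Continuous.subtype_mk (continuous_pi fun k => G.continuous_contractNth j k) _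

theorem isLocalHomeomorph_face_zero (n : ℕ) : IsLocalHomeomorph (G.face n 0) := by
  refine G.isLocalHomeomorph_src.of_isPullback (b := G.firstUnit n) (p := fun g => g.1 0)
    (G.continuous_firstUnit n) ?_ ?_ ?_
  · cases n with
    | zero =>
      have h : Topology.IsEmbedding fun g : G.Strings 1 => g.1 0 :=
        (Homeomorph.funUnique (Fin 1) G.Arr).isEmbedding.comp Topology.IsEmbedding.subtypeVal
      exact .of_comp (g := Prod.snd)
        ((G.continuous_face 0 0).prodMk h.continuous) continuous_snd h
    | succ n =>
      refine .of_comp (g := fun p : G.Strings (n + 1) × G.Arr =>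
        (Fin.cons p.2 p.1.1 : Fin (n + 2) → G.Arr))
        ((G.continuous_face (n + 1) 0).prodMk
          ((continuous_apply 0).comp continuous_subtype_val)) ?_ ?_
      · exact Continuous.finCons continuous_snd (continuous_subtype_val.comp continuous_fst)
      · convert! (Topology.IsEmbedding.subtypeVal : Topology.IsEmbedding fun g : {g : Fin (n + 2) →
          G.Arr // ∀ i : Fin (n + 1), G.src (g i.castSucc) = G.rng (g i.succ)} => g.1) using 1
        funext g
        exact Fin.cons_self_tail g.1
  · intro w
    cases n with
    | zero => rfl
    | succ n => exact (w.2 0).symm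
  · intro x y hxy
    cases n with
    | zero => exact ⟨⟨fun _ => y, fun i => i.elim0⟩, hxy.symm, rfl⟩
    | succ n =>
      refine ⟨⟨Fin.cons y x.1, fun i => ?_⟩, rfl, rfl⟩
      induction i using Fin.cases with
      | zero => exact hxy.symm
      | succ i => exact x.2 i

theorem isLocalHomeomorph_lastUnit (n : ℕ) : IsLocalHomeomorph (G.lastUnit n) := by
  induction n with
  | zero => exact (Homeomorph.refl G.Obj).isLocalHomeomorph
  | succ n ih =>
    have : G.lastUnit (n + 1) = G.lastUnit n ∘ G.face n 0 := by
      funext g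
      cases n <;> rfl
    rw [this]
    exact ih.comp (G.isLocalHomeomorph_face_zero n)

theorem isLocalHomeomorph_lastArr (n : ℕ) :
    IsLocalHomeomorph fun g : G.Strings (n + 1) => g.1 (Fin.last n) :=
  IsLocalHomeomorph.of_comp (g := G.src) (G.isLocalHomeomorph_lastUnit (n + 1))
    G.isLocalHomeomorph_src ((continuous_apply _).comp continuous_subtype_val)

theorem lastUnit_face (n : ℕ) (i : Fin (n + 2)) (g : G.Strings (n + 1)) :
    G.lastUnit n (G.face n i g) =
      if (i : ℕ) = n + 1 then G.rng (g.1 (Fin.last n)) else G.src (g.1 (Fin.last n)) := by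
  cases n with
  | zero => fin_cases i <;> rfl
  | succ n =>
    induction i using Fin.cases with
    | zero => rfl
    | succ j =>
      have h := g.2 (Fin.last n)
      change G.src (j.contractNth G.mul g.1 (Fin.last n)) = _
      unfold Fin.contractNth
      simp only [Fin.val_last, Fin.val_succ]
      have := j.2
      split_ifs <;> first | omega | skip
      · exact h
      · exact G.src_mul _ _ h
      · rfl

theorem isLocalHomeomorph_face (n : ℕ) (i : Fin (n + 2)) : IsLocalHomeomorph (G.face n i) := by
  refine IsLocalHomeomorph.of_comp (g := G.lastUnit n) ?_ (G.isLocalHomeomorph_lastUnit n)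
    (G.continuous_face n i)
  have h : G.lastUnit n ∘ G.face n i = fun g => if (i : ℕ) = n + 1 then
      G.rng (g.1 (Fin.last n)) else G.src (g.1 (Fin.last n)) :=
    funext (G.lastUnit_face n i)
  rw [h]
  split_ifs
  · exact G.isLocalHomeomorph_rng.comp (G.isLocalHomeomorph_lastArr n)
  · exact G.isLocalHomeomorph_src.comp (G.isLocalHomeomorph_lastArr n)

/-- The boundary map `δ_{n+1} = ∑_i (-1)^i d_{i*} : C_c(G^(n+1), ℤ) → C_c(G^(n), ℤ)`;
in particular `δ_1 = s_* - r_*`. -/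
noncomputable def boundary (n : ℕ) : C_c(G.Strings (n + 1), ℤ) →+ C_c(G.Strings n, ℤ) :=
  ∑ i : Fin (n + 2), (-1 : ℤ) ^ (i : ℕ) • pushforward (G.face n i) (G.isLocalHomeomorph_face n i)

theorem face_succ_apply {n : ℕ} (i : Fin (n + 3)) (g : G.Strings (n + 2)) (k : Fin (n + 1)) :
    (G.face (n + 1) i g).1 k = if (k : ℕ) + 1 < i then g.1 k.castSucc else
      if (k : ℕ) + 1 = i then G.mul (g.1 k.castSucc) (g.1 k.succ) else g.1 k.succ := by
  induction i using Fin.cases with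
  | zero => simp; rfl
  | succ j =>
    change j.contractNth G.mul g.1 k = _
    unfold Fin.contractNth
    simp only [Fin.val_succ, Nat.add_lt_add_iff_right, Nat.add_right_cancel_iff]

theorem face_face {n : ℕ} (i : Fin (n + 2)) (j : Fin (n + 2)) (hij : i ≤ j)
    (g : G.Strings (n + 2)) :
    G.face n i (G.face (n + 1) j.succ g) = G.face n j (G.face (n + 1) i.castSucc g) := by
  cases n with
  | zero =>
    have h : G.src (g.1 0) = G.rng (g.1 1) := g.2 0
    fin_cases i <;> fin_cases j
    · exact G.src_mul _ _ h
    · exact h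
    · exact absurd hij (by decide)
    · exact (G.rng_mul _ _ h).symm
  | succ n =>
    refine Subtype.ext (funext fun k => ?_)
    have h1 := g.2 k.castSucc
    have h2 := g.2 k.succ
    rw [Fin.le_def] at hij
    simp only [face_succ_apply, Fin.val_castSucc, Fin.val_succ]
    split_ifs <;> first | omega | rfl | skip
    exact (G.mul_assoc _ _ _ h1 h2).symm

theorem boundary_boundary (n : ℕ) (f : C_c(G.Strings (n + 2), ℤ)) :
    G.boundary n (G.boundary (n + 1) f) = 0 := by
  simp only [boundary, AddMonoidHom.finsetSum_apply, AddMonoidHom.smul_apply, map_sum, map_zsmul,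
    Finset.smul_sum, smul_smul, pushforward_comp]
  rw [Finset.sum_comm]
  simp only [← Finset.sum_product']
  let P := Fin (n + 2) × Fin (n + 3)
  let S : Finset P := {ij : P | (ij.2 : ℕ) ≤ (ij.1 : ℕ)}
  rw [Finset.univ_product_univ, ← Finset.sum_add_sum_compl S, ← eq_neg_iff_add_eq_zero,
    ← Finset.sum_neg_distrib]
  let φ : ∀ ij : P, ij ∈ S → P := fun ij hij =>
    (Fin.castLT ij.2 (lt_of_le_of_lt (Finset.mem_filter.mp hij).right (Fin.is_lt ij.1)), ij.1.succ)
  apply Finset.sum_bij φ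
  · intro ij hij
    simp_rw [S, φ, Finset.compl_filter, Finset.mem_filter_univ, Fin.val_succ,
      Fin.val_castLT] at hij ⊢
    omega
  · rintro ⟨i, j⟩ hij ⟨i', j'⟩ hij' h
    rw [Prod.mk_inj]
    exact ⟨by simpa [φ] using! congr_arg Prod.snd h,
      by simpa [φ, Fin.castSucc_castLT] using! congr_arg Fin.castSucc (congr_arg Prod.fst h)⟩
  · rintro ⟨i', j'⟩ hij'
    simp_rw [S, Finset.compl_filter, Finset.mem_filter_univ, not_le] at hij'
    refine ⟨(j'.pred <| ?_, Fin.castSucc i'), ?_, ?_⟩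
    · rintro rfl
      simp only [Fin.val_zero, not_lt_zero] at hij'
    · simpa [S] using! Nat.le_sub_one_of_lt hij'
    · simp only [φ, Fin.castLT_castSucc, Fin.succ_pred]
  · rintro ⟨i, j⟩ hij
    have hji : (j : ℕ) ≤ i := by simpa [S] using hij
    rw [← neg_smul]
    congr 1
    · simp only [φ, Fin.val_succ, Fin.val_castLT]
      ring
    · have : G.face n i ∘ G.face (n + 1) j =
          G.face n (φ (i, j) hij).1 ∘ G.face (n + 1) (φ (i, j) hij).2 := by
        funext g
        exact (G.face_face (j.castLT (lt_of_le_of_lt hji i.2)) i hji g).symm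
      simp only [this]

/-- The cycles: the kernel of `δ_n`, where `δ_0 = 0`. -/
noncomputable def cycles : (n : ℕ) → AddSubgroup C_c(G.Strings n, ℤ)
  | 0 => ⊤
  | n + 1 => (G.boundary n).ker

/-- The homology group `H_n(G) = ker δ_n / im δ_{n+1}` of the chain complex `C_c(G^(•), ℤ)`
(a chain complex by `boundary_boundary`). -/
def Homology (n : ℕ) : Type u :=
  G.cycles n ⧸ (G.boundary n).range.addSubgroupOf (G.cycles n)

noncomputable instance (n : ℕ) : AddCommGroup (G.Homology n) :=
  inferInstanceAs (AddCommGroup (G.cycles n ⧸ (G.boundary n).range.addSubgroupOf (G.cycles n)))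

/-- A continuous groupoid homomorphism from `G` to the (discrete) group `ℤ`. -/
structure IntHom where
  toFun : G.Arr → ℤ
  map_mul : ∀ g h, G.src g = G.rng h → toFun (G.mul g h) = toFun g + toFun h
  continuous_toFun : Continuous toFun

variable {G}

namespace IntHom

theorem map_one (ρ : G.IntHom) (x : G.Obj) : ρ.toFun (G.one x) = 0 := by
  have h := ρ.map_mul (G.one x) (G.one x) (by rw [G.src_one, G.rng_one])
  have h1 : G.mul (G.one x) (G.one x) = G.one x := by
    simpa only [G.rng_one] using G.one_mul (G.one x)
  rw [h1] at h
  omega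

theorem map_inv (ρ : G.IntHom) (g : G.Arr) : ρ.toFun (G.inv g) = -ρ.toFun g := by
  have h := ρ.map_mul (G.inv g) g (G.src_inv g)
  rw [G.inv_mul, ρ.map_one] at h
  omega

/-- The inverse of `G` restricted to the kernel of `ρ`. -/
def kerInv (ρ : G.IntHom) (g : {g : G.Arr // ρ.toFun g = 0}) : {g : G.Arr // ρ.toFun g = 0} :=
  ⟨G.inv g.1, by rw [ρ.map_inv, g.2, neg_zero]⟩

theorem isLocalHomeomorph_kerVal (ρ : G.IntHom) :
    IsLocalHomeomorph (Subtype.val : {g : G.Arr // ρ.toFun g = 0} → G.Arr) :=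
  ((isOpen_discrete {(0 : ℤ)}).preimage
    ρ.continuous_toFun).isOpenEmbedding_subtypeVal.isLocalHomeomorph

open scoped Classical in
/-- The product of `G` restricted to the kernel of `ρ`; the value on pairs that are not composable
is irrelevant. -/
noncomputable def kerMul (ρ : G.IntHom) (g h : {g : G.Arr // ρ.toFun g = 0}) :
    {g : G.Arr // ρ.toFun g = 0} :=
  if hgh : G.src g.1 = G.rng h.1 then
    ⟨G.mul g.1 h.1, by rw [ρ.map_mul _ _ hgh, g.2, h.2, add_zero]⟩ else g

theorem kerMul_val (ρ : G.IntHom) (g h : {g : G.Arr // ρ.toFun g = 0})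
    (hgh : G.src g.1 = G.rng h.1) : (ρ.kerMul g h).1 = G.mul g.1 h.1 := by
  rw [kerMul, dif_pos hgh]

theorem continuous_kerMul (ρ : G.IntHom) :
    Continuous fun p : {p : {g : G.Arr // ρ.toFun g = 0} × {g : G.Arr // ρ.toFun g = 0} //
      G.src p.1.1 = G.rng p.2.1} => ρ.kerMul p.1.1 p.1.2 := by
  refine Topology.IsInducing.subtypeVal.continuous_iff.2 ?_
  have h : Continuous fun p : {p : {g : G.Arr // ρ.toFun g = 0} × {g : G.Arr // ρ.toFun g = 0} //
      G.src p.1.1 = G.rng p.2.1} => (⟨(p.1.1.1, p.1.2.1), p.2⟩ :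
        {p : G.Arr × G.Arr // G.src p.1 = G.rng p.2}) := by fun_prop
  refine (G.continuous_mul.comp h).congr fun p => ?_
  exact (ρ.kerMul_val _ _ p.2).symm

/-- The kernel of a continuous homomorphism `ρ : G → ℤ`: the open subgroupoid of the arrows `g`
with `ρ g = 0`, with the subspace topology and the same units as `G`. -/
noncomputable def ker (ρ : G.IntHom) : EtaleGroupoid.{u} where
  Obj := G.Obj
  Arr := {g : G.Arr // ρ.toFun g = 0}
  src g := G.src g.1
  rng g := G.rng g.1
  one x := ⟨G.one x, ρ.map_one x⟩
  inv := ρ.kerInv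
  mul := ρ.kerMul
  src_one x := G.src_one x
  rng_one x := G.rng_one x
  src_inv g := G.src_inv g.1
  rng_inv g := G.rng_inv g.1
  src_mul g h hgh := by rw [ρ.kerMul_val _ _ hgh, G.src_mul _ _ hgh]
  rng_mul g h hgh := by rw [ρ.kerMul_val _ _ hgh, G.rng_mul _ _ hgh]
  mul_assoc g h k hgh hhk := by
    have h1 : G.src (ρ.kerMul g h).1 = G.rng k.1 := by
      rw [ρ.kerMul_val _ _ hgh, G.src_mul _ _ hgh, hhk]
    have h2 : G.src g.1 = G.rng (ρ.kerMul h k).1 := by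
      rw [ρ.kerMul_val _ _ hhk, G.rng_mul _ _ hhk, hgh]
    apply Subtype.ext
    rw [ρ.kerMul_val _ _ h1, ρ.kerMul_val _ _ h2, ρ.kerMul_val _ _ hgh, ρ.kerMul_val _ _ hhk,
      G.mul_assoc _ _ _ hgh hhk]
  one_mul g := Subtype.ext ((ρ.kerMul_val _ _ (G.src_one _)).trans (G.one_mul g.1))
  mul_one g := Subtype.ext ((ρ.kerMul_val _ _ (G.rng_one _).symm).trans (G.mul_one g.1))
  inv_mul g := Subtype.ext ((ρ.kerMul_val _ _ (G.src_inv _)).trans (G.inv_mul g.1))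
  mul_inv g := Subtype.ext ((ρ.kerMul_val _ _ (G.rng_inv _).symm).trans (G.mul_inv g.1))
  continuous_one := G.continuous_one.subtype_mk _
  continuous_inv := (G.continuous_inv.comp continuous_subtype_val).subtype_mk _
  continuous_mul := ρ.continuous_kerMul
  isLocalHomeomorph_src := G.isLocalHomeomorph_src.comp ρ.isLocalHomeomorph_kerVal
  isLocalHomeomorph_rng := G.isLocalHomeomorph_rng.comp ρ.isLocalHomeomorph_kerVal

end IntHom

end EtaleGroupoid

/-! ### The Katsura–Exel–Pardo groupoid -/

namespace Katsura

variable {V : Type u}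

/-- The edges `e_{i,j,n}`, `0 ≤ n < A i j`, of the graph of `A`, from `src = i` to `rng = j`. -/
@[ext]
structure Edge (A : Matrix V V ℤ) where
  src : V
  rng : V
  idx : ℤ
  idx_nonneg : 0 ≤ idx
  idx_lt : idx < A src rng

/-- A matrix with integer entries is row-finite, `∑_j |A i j| < ∞` for all `i`, if and only if
each of its rows has finitely many nonzero entries. -/
def RowFinite (A : Matrix V V ℤ) : Prop := ∀ i, {j | A i j ≠ 0}.Finite

variable {A : Matrix V V ℤ} (B : Matrix V V ℤ)

theorem Edge.pos (e : Edge A) : 0 < A e.src e.rng := e.idx_nonneg.trans_lt e.idx_lt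

/-- The action of `m : ℤ` on edges: `κ_m (e_{i,j,n}) = e_{i,j,l}` where
`m B_{i,j} + n = k A_{i,j} + l` and `0 ≤ l < A_{i,j}`. -/
def kappa (m : ℤ) (e : Edge A) : Edge A where
  src := e.src
  rng := e.rng
  idx := (m * B e.src e.rng + e.idx) % A e.src e.rng
  idx_nonneg := Int.emod_nonneg _ e.pos.ne'
  idx_lt := Int.emod_lt_of_pos _ e.pos

/-- The one-cocycle `φ (m, e_{i,j,n}) = k` where `m B_{i,j} + n = k A_{i,j} + l` and
`0 ≤ l < A_{i,j}`. -/
def phi (m : ℤ) (e : Edge A) : ℤ := (m * B e.src e.rng + e.idx) / A e.src e.rng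

/-- The pair `A`, `B` is pseudo free. -/
def PseudoFree (A B : Matrix V V ℤ) : Prop :=
  ∀ (m : ℤ) (e : Edge A), kappa B m e = e → phi B m e = 0 → m = 0

theorem kappa_add (m₁ m₂ : ℤ) (e : Edge A) :
    kappa B (m₁ + m₂) e = kappa B m₁ (kappa B m₂ e) := by
  refine Edge.ext rfl rfl ?_
  simp only [kappa, Int.add_emod_emod]
  ring_nf

theorem phi_add (m₁ m₂ : ℤ) (e : Edge A) :
    phi B (m₁ + m₂) e = phi B m₁ (kappa B m₂ e) + phi B m₂ e := by
  simp only [phi, kappa]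
  rw [← Int.add_mul_ediv_left _ _ e.pos.ne', add_assoc, Int.emod_add_mul_ediv]
  ring_nf

theorem kappa_zero (e : Edge A) : kappa B 0 e = e := by
  refine Edge.ext rfl rfl ?_
  simp only [kappa, zero_mul, zero_add]
  exact Int.emod_eq_of_lt e.idx_nonneg e.idx_lt

theorem phi_zero (e : Edge A) : phi B 0 e = 0 := by
  simp only [phi, zero_mul, zero_add]
  exact Int.ediv_eq_zero_of_lt e.idx_nonneg e.idx_lt

theorem kappa_neg_kappa (m : ℤ) (e : Edge A) : kappa B (-m) (kappa B m e) = e := by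
  rw [← kappa_add, neg_add_cancel, kappa_zero]

theorem phi_neg_kappa (m : ℤ) (e : Edge A) : phi B (-m) (kappa B m e) = -phi B m e := by
  have h := phi_add B (-m) m e
  rw [neg_add_cancel, phi_zero] at h
  omega

theorem PseudoFree.eq_of_eq {B : Matrix V V ℤ} (h : PseudoFree A B) {m m' : ℤ} {e : Edge A}
    (h1 : kappa B m e = kappa B m' e) (h2 : phi B m e = phi B m' e) : m = m' := by
  have h3 := h (m - m') (kappa B m' e) (by rw [← kappa_add, sub_add_cancel, h1]) (by
    have := phi_add B (m - m') m' e
    rw [sub_add_cancel, h2] at this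
    omega)
  omega

/-- The list `l` of edges is a path that starts at the vertex `v`. -/
def IsPath (v : V) : List (Edge A) → Prop
  | [] => True
  | e :: l => e.src = v ∧ IsPath e.rng l

/-- The vertex at which a path from `v` along the list `l` of edges ends. -/
def endpoint (v : V) : List (Edge A) → V
  | [] => v
  | e :: l => endpoint e.rng l

variable (A) in
/-- The finite paths, including the paths of length zero, which are the vertices. -/
@[ext]
structure FinPath where
  src : V
  edges : List (Edge A)
  isPath : IsPath src edges

variable (A) in
/-- The infinite path space, with the topology induced by the product of discrete spaces. -/
abbrev InfPath : Type u := {x : ℕ → Edge A // ∀ i, (x i).rng = (x (i + 1)).src}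

instance : TopologicalSpace (Edge A) := ⊥

instance : DiscreteTopology (Edge A) := ⟨rfl⟩

theorem isPath_append (v : V) (l l' : List (Edge A)) :
    IsPath v (l ++ l') ↔ IsPath v l ∧ IsPath (endpoint v l) l' := by
  induction l generalizing v with
  | nil => simp [IsPath, endpoint]
  | cons e l ih => simp [IsPath, endpoint, ih, and_assoc]

theorem endpoint_append (v : V) (l l' : List (Edge A)) :
    endpoint v (l ++ l') = endpoint (endpoint v l) l' := by
  induction l generalizing v with
  | nil => rfl
  | cons e l ih => exact ih _

namespace FinPath

/-- The range of a finite path. -/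
def rng (α : FinPath A) : V := endpoint α.src α.edges

/-- The length of a finite path. -/
def length (α : FinPath A) : ℕ := α.edges.length

/-- The path of length zero at a vertex. -/
def vertex (v : V) : FinPath A := ⟨v, [], trivial⟩

/-- The path `αe` for an edge `e` that starts where `α` ends. -/
def snoc (α : FinPath A) (e : Edge A) (h : e.src = α.rng) : FinPath A :=
  ⟨α.src, α.edges ++ [e], (isPath_append _ _ _).2 ⟨α.isPath, h, trivial⟩⟩

theorem rng_snoc (α : FinPath A) (e : Edge A) (h : e.src = α.rng) : (α.snoc e h).rng = e.rng :=
  endpoint_append _ _ _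

theorem length_snoc (α : FinPath A) (e : Edge A) (h : e.src = α.rng) :
    (α.snoc e h).length = α.length + 1 := by
  simp [length, snoc]

theorem snoc_inj {α α' : FinPath A} {e e' : Edge A} {h : e.src = α.rng} {h' : e'.src = α'.rng}
    (hs : α.snoc e h = α'.snoc e' h') : α = α' ∧ e = e' := by
  have h1 : α.src = α'.src := (congrArg FinPath.src hs :)
  have h2 : α.edges ++ [e] = α'.edges ++ [e'] := (congrArg FinPath.edges hs :)
  obtain ⟨h3, h4⟩ := List.append_inj' h2 rfl
  exact ⟨FinPath.ext h1 h3, by simpa using h4⟩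

end FinPath

/-- The sequence that starts with the list `l` and goes on with the sequence `y`. -/
def prepend : List (Edge A) → (ℕ → Edge A) → ℕ → Edge A
  | [], y => y
  | e :: l, y => fun n => Nat.casesOn n e (prepend l y)

theorem prepend_add (l : List (Edge A)) (y : ℕ → Edge A) (n : ℕ) :
    prepend l y (l.length + n) = y n := by
  induction l with
  | nil => simp [prepend]
  | cons e l ih => rw [List.length_cons, add_right_comm]; exact ih

theorem prepend_lt (l : List (Edge A)) (y : ℕ → Edge A) (n : ℕ) (h : n < l.length) :
    prepend l y n = l[n] := by
  induction l generalizing n with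
  | nil => simp at h
  | cons e l ih =>
    cases n with
    | zero => rfl
    | succ n => exact ih n (by simpa using h)

theorem prepend_snoc (l : List (Edge A)) (e : Edge A) (y : ℕ → Edge A) :
    prepend (l ++ [e]) y = prepend l (prepend [e] y) := by
  induction l with
  | nil => rfl
  | cons a l ih =>
    funext n
    cases n with
    | zero => rfl
    | succ n => exact congrFun ih n

theorem isPath_prepend_aux {v : V} {l : List (Edge A)} (hl : IsPath v l) {y : ℕ → Edge A}
    (hy : ∀ i, (y i).rng = (y (i + 1)).src) (h : (y 0).src = endpoint v l) :
    (prepend l y 0).src = v ∧ ∀ i, (prepend l y i).rng = (prepend l y (i + 1)).src := by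
  induction l generalizing v with
  | nil => exact ⟨h, hy⟩
  | cons e l ih =>
    obtain ⟨h1, h2⟩ := ih hl.2 h
    refine ⟨hl.1, fun i => ?_⟩
    cases i with
    | zero => exact h1.symm
    | succ i => exact h2 i

namespace InfPath

/-- The source of an infinite path. -/
def src (x : InfPath A) : V := (x.1 0).src

/-- The path obtained from `x` by deleting the first `n` edges. -/
def drop (n : ℕ) (x : InfPath A) : InfPath A :=
  ⟨fun i => x.1 (n + i), fun i => x.2 (n + i)⟩

end InfPath

/-- The concatenation `αy`. -/
def FinPath.append (α : FinPath A) (y : InfPath A) (h : y.src = α.rng) : InfPath A :=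
  ⟨prepend α.edges y.1, (isPath_prepend_aux α.isPath y.2 h).2⟩

theorem FinPath.src_append (α : FinPath A) (y : InfPath A) (h : y.src = α.rng) :
    (α.append y h).src = α.src := (isPath_prepend_aux α.isPath y.2 h).1

/-- The cylinder set `Z(α)` of the infinite paths that start with `α`. -/
def cylinder (α : FinPath A) : Set (InfPath A) :=
  {x | ∃ (y : InfPath A) (h : y.src = α.rng), x = α.append y h}

theorem FinPath.drop_append (α : FinPath A) (y : InfPath A) (h : y.src = α.rng) :
    (α.append y h).drop α.length = y :=
  Subtype.ext (funext fun n => prepend_add α.edges y.1 n)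

theorem src_drop_of_mem {α : FinPath A} {x : InfPath A} (hx : x ∈ cylinder α) :
    (x.drop α.length).src = α.rng := by
  obtain ⟨y, h, rfl⟩ := hx
  rw [α.drop_append, h]

theorem append_drop_of_mem {α : FinPath A} {x : InfPath A} (hx : x ∈ cylinder α) :
    α.append (x.drop α.length) (src_drop_of_mem hx) = x := by
  obtain ⟨y, h, rfl⟩ := hx
  simp only [α.drop_append]

theorem mem_cylinder_append (α : FinPath A) (y : InfPath A) (h : y.src = α.rng) :
    α.append y h ∈ cylinder α := ⟨y, h, rfl⟩

theorem cylinder_getElem {α : FinPath A} {x : InfPath A} (hx : x ∈ cylinder α) (n : ℕ)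
    (hn : n < α.edges.length) : α.edges[n] = x.1 n := by
  obtain ⟨y, h, rfl⟩ := hx
  exact (prepend_lt _ _ _ hn).symm

theorem cylinder_src {α : FinPath A} {x : InfPath A} (hx : x ∈ cylinder α) : x.src = α.src := by
  obtain ⟨y, h, rfl⟩ := hx
  exact α.src_append y h

/-- A finite path is determined by its length and an infinite path that extends it. -/
theorem eq_of_mem_cylinder {α α' : FinPath A} {x : InfPath A} (hx : x ∈ cylinder α)
    (hx' : x ∈ cylinder α') (h : α.length = α'.length) : α = α' := by
  refine FinPath.ext ((cylinder_src hx).symm.trans (cylinder_src hx')) ?_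
  refine List.ext_getElem h fun n h1 h2 => ?_
  rw [cylinder_getElem hx, cylinder_getElem hx']

theorem mem_cylinder_snoc {α : FinPath A} {x : InfPath A} (hx : x ∈ cylinder α)
    (h : (x.1 α.length).src = α.rng) : x ∈ cylinder (α.snoc (x.1 α.length) h) := by
  have h2 : (x.drop (α.length + 1)).src = (α.snoc (x.1 α.length) h).rng := by
    rw [α.rng_snoc]; exact (x.2 α.length).symm
  refine ⟨x.drop (α.length + 1), h2, ?_⟩
  conv_lhs => rw [← append_drop_of_mem hx]
  refine Subtype.ext ?_
  change prepend α.edges _ = prepend (α.edges ++ [x.1 α.length]) _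
  rw [prepend_snoc]
  congr 1
  funext n
  cases n with
  | zero => rfl
  | succ n => exact congrArg x.1 (by omega)

theorem mem_cylinder_of_snoc {α : FinPath A} {x : InfPath A} {e : Edge A} {h : e.src = α.rng}
    (hx : x ∈ cylinder (α.snoc e h)) : x ∈ cylinder α ∧ x.1 α.length = e := by
  obtain ⟨y, h', rfl⟩ := hx
  rw [α.rng_snoc] at h'
  have h1 : InfPath.src (A := A) ⟨prepend [e] y.1,
      (isPath_prepend_aux (v := α.rng) (l := [e]) ⟨h, trivial⟩ y.2 h').2⟩ = α.rng := h
  have h2 : α.append _ h1 = (α.snoc e h).append y (by rw [α.rng_snoc]; exact h') :=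
    Subtype.ext (prepend_snoc α.edges e y.1).symm
  rw [← h2]
  exact ⟨mem_cylinder_append _ _ _, prepend_add α.edges _ 0⟩

theorem isOpen_agree (x : InfPath A) (n : ℕ) : IsOpen {z : InfPath A | ∀ i < n, z.1 i = x.1 i} := by
  have h : {z : InfPath A | ∀ i < n, z.1 i = x.1 i} =
      ⋂ i ∈ Finset.range n, (fun z : InfPath A => z.1 i) ⁻¹' {x.1 i} := by
    ext z
    simp
  rw [h]
  exact isOpen_biInter_finset fun i _ =>
    (isOpen_discrete _).preimage ((continuous_apply i).comp continuous_subtype_val)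

theorem exists_agree_subset {W : Set (InfPath A)} (hW : IsOpen W) {x : InfPath A} (hx : x ∈ W) :
    ∃ n, ∀ z : InfPath A, (∀ i < n, z.1 i = x.1 i) → z ∈ W := by
  obtain ⟨O, hO, rfl⟩ := isOpen_induced_iff.1 hW
  obtain ⟨I, u, hu, hIu⟩ := isOpen_pi_iff.1 hO x.1 hx
  refine ⟨I.sup id + 1, fun z hz => hIu fun i hi => ?_⟩
  have : i ≤ I.sup id := Finset.le_sup (f := id) hi
  rw [hz i (by omega)]
  exact (hu i hi).2

theorem isOpen_cylinder (α : FinPath A) : IsOpen (cylinder α) := by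
  refine isOpen_iff_forall_mem_open.2 fun x hx =>
    ⟨_, fun z hz => ?_, isOpen_agree x (α.length + 1), fun i _ => rfl⟩
  have h : (z.drop α.length).src = α.rng := by
    rw [← src_drop_of_mem hx]
    exact congrArg Edge.src (hz α.length (by omega))
  refine ⟨z.drop α.length, h, Subtype.ext (funext fun n => ?_)⟩
  change _ = prepend α.edges _ n
  rcases lt_or_ge n α.edges.length with hn | hn
  · rw [prepend_lt _ _ _ hn, cylinder_getElem hx]
    exact hz n (Nat.lt_succ_of_lt hn)
  · obtain ⟨k, rfl⟩ := Nat.exists_eq_add_of_le hn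
    rw [prepend_add]
    rfl

theorem agree_of_mem_cylinder {α : FinPath A} {x z : InfPath A} (hx : x ∈ cylinder α)
    (hz : z ∈ cylinder α) (i : ℕ) (hi : i < α.length) : z.1 i = x.1 i := by
  rw [← cylinder_getElem hx i hi, ← cylinder_getElem hz i hi]

/-- Along an infinite path `y` the cocycle takes the values `φ (m, y_1 ⋯ y_n)`. -/
def phiSeq (m : ℤ) (y : ℕ → Edge A) : ℕ → ℤ
  | 0 => m
  | n + 1 => phi B (phiSeq m y n) (y n)

/-- The action of `m : ℤ` on infinite paths,
`κ_m (y_1 y_2 ⋯) = κ_m (y_1) κ_{φ (m, y_1)} (y_2) κ_{φ (m, y_1 y_2)} (y_3) ⋯`. -/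
def act (m : ℤ) (y : InfPath A) : InfPath A :=
  ⟨fun n => kappa B (phiSeq B m y.1 n) (y.1 n), fun i => y.2 i⟩

theorem phiSeq_add (m₁ m₂ : ℤ) (y : InfPath A) (n : ℕ) :
    phiSeq B (m₁ + m₂) y.1 n = phiSeq B m₁ (act B m₂ y).1 n + phiSeq B m₂ y.1 n := by
  induction n with
  | zero => rfl
  | succ n ih => rw [phiSeq, ih, phi_add]; rfl

theorem act_add (m₁ m₂ : ℤ) (y : InfPath A) : act B (m₁ + m₂) y = act B m₁ (act B m₂ y) := by
  refine Subtype.ext (funext fun n => ?_)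
  change kappa B (phiSeq B (m₁ + m₂) y.1 n) (y.1 n) = _
  rw [phiSeq_add, kappa_add]
  rfl

theorem act_zero (y : InfPath A) : act B 0 y = y := by
  have h : ∀ n, phiSeq B 0 y.1 n = 0 := by
    intro n
    induction n with
    | zero => rfl
    | succ n ih => rw [phiSeq, ih, phi_zero]
  refine Subtype.ext (funext fun n => ?_)
  change kappa B (phiSeq B 0 y.1 n) (y.1 n) = y.1 n
  rw [h, kappa_zero]

theorem phiSeq_succ' (m : ℤ) (y : ℕ → Edge A) (n : ℕ) :
    phiSeq B m y (n + 1) = phiSeq B (phi B m (y 0)) (fun i => y (1 + i)) n := by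
  induction n with
  | zero => rfl
  | succ n ih =>
    rw [phiSeq, ih, phiSeq, add_comm 1 n]

variable (A) in
/-- The quadruples `(α, m, β; x)` with `r(α) = r(β)` and `x ∈ Z(β)`. -/
@[ext]
structure Quad where
  α : FinPath A
  m : ℤ
  β : FinPath A
  x : InfPath A
  rng_eq : α.rng = β.rng
  mem : x ∈ cylinder β

/-- The generating relation `(α, m, β; x) ∼ (α κ_m(γ), φ(m, γ), βγ; x)`, where `x = βγy`. -/
def Step (q q' : Quad A) : Prop :=
  ∃ (γ : Edge A) (h : γ.src = q.β.rng),
    q'.α = q.α.snoc (kappa B q.m γ) (h.trans q.rng_eq.symm) ∧ q'.m = phi B q.m γ ∧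
      q'.β = q.β.snoc γ h ∧ q'.x = q.x

variable (A) in
/-- The arrows of the Katsura–Exel–Pardo groupoid: the classes `[α, m, β; x]` for the equivalence
relation generated by `Step`. -/
def Arrow : Type u := Quot (Step (A := A) B)

/-- The class `[α, m, β; x]`. -/
def mk (q : Quad A) : Arrow A B := Quot.mk _ q

namespace Quad

/-- The range `α κ_m(y)` of `(α, m, β; x)`, where `x = βy`. -/
def rng (q : Quad A) : InfPath A :=
  q.α.append (act B q.m (q.x.drop q.β.length)) ((src_drop_of_mem q.mem).trans q.rng_eq.symm)

theorem rng_mem (q : Quad A) : q.rng B ∈ cylinder q.α := mem_cylinder_append _ _ _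

theorem src_next (q : Quad A) : (q.x.1 q.β.length).src = q.β.rng := src_drop_of_mem q.mem

/-- The quadruple that represents the same class with `β` longer by one edge. -/
def next (q : Quad A) : Quad A where
  α := q.α.snoc (kappa B q.m (q.x.1 q.β.length)) (q.src_next.trans q.rng_eq.symm)
  m := phi B q.m (q.x.1 q.β.length)
  β := q.β.snoc (q.x.1 q.β.length) q.src_next
  x := q.x
  rng_eq := 
    (FinPath.rng_snoc _ _ _).trans (FinPath.rng_snoc _ (q.x.1 q.β.length) q.src_next).symm
  mem := mem_cylinder_snoc q.mem q.src_next

theorem next_length_α (q : Quad A) : (q.next B).α.length = q.α.length + 1 :=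
  FinPath.length_snoc q.α (kappa B q.m (q.x.1 q.β.length)) (q.src_next.trans q.rng_eq.symm)

theorem next_length_β (q : Quad A) : (q.next B).β.length = q.β.length + 1 :=
  FinPath.length_snoc _ _ q.src_next

end Quad

theorem step_iff (q q' : Quad A) : Step B q q' ↔ q' = q.next B := by
  constructor
  · rintro ⟨γ, h, h1, h2, h3, h4⟩
    have h5 : q'.x ∈ cylinder (q.β.snoc γ h) := h3 ▸ q'.mem
    rw [h4] at h5
    obtain rfl := (mem_cylinder_of_snoc h5).2
    exact Quad.ext h1 h2 h3 h4
  · rintro rfl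
    exact ⟨_, q.src_next, rfl, rfl, rfl, rfl⟩

theorem mk_next (q : Quad A) : mk B (q.next B) = mk B q :=
  (Quot.sound ((step_iff B q _).2 rfl)).symm

theorem mk_iterate_next (q : Quad A) (n : ℕ) : mk B ((Quad.next B)^[n] q) = mk B q := by
  induction n with
  | zero => rfl
  | succ n ih => rw [Function.iterate_succ_apply', mk_next, ih]

theorem mk_eq_iff (q q' : Quad A) :
    mk B q = mk B q' ↔ ∃ a b, (Quad.next B)^[a] q = (Quad.next B)^[b] q' := by
  constructor
  · intro h
    have h' := Quot.eqvGen_exact h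
    clear h
    induction h' with
    | rel q q' h => exact ⟨1, 0, ((step_iff B q q').1 h).symm⟩
    | refl q => exact ⟨0, 0, rfl⟩
    | symm q q' h ih =>
      obtain ⟨a, b, hab⟩ := ih
      exact ⟨b, a, hab.symm⟩
    | trans q q' q'' h h' ih ih' =>
      obtain ⟨a, b, hab⟩ := ih
      obtain ⟨c, d, hcd⟩ := ih'
      refine ⟨c + a, b + d, ?_⟩
      rw [Function.iterate_add_apply, hab, ← Function.iterate_add_apply, add_comm c b,
        Function.iterate_add_apply, hcd, ← Function.iterate_add_apply]
  · rintro ⟨a, b, h⟩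
    rw [← mk_iterate_next B q a, h, mk_iterate_next]

namespace Quad

theorem iterate_x (q : Quad A) (n : ℕ) : ((next B)^[n] q).x = q.x := by
  induction n with
  | zero => rfl
  | succ n ih => rw [Function.iterate_succ_apply']; exact ih

theorem iterate_length_β (q : Quad A) (n : ℕ) :
    ((next B)^[n] q).β.length = q.β.length + n := by
  induction n with
  | zero => rfl
  | succ n ih =>
    rw [Function.iterate_succ_apply', next_length_β, ih, add_assoc]

theorem iterate_length_α (q : Quad A) (n : ℕ) :
    ((next B)^[n] q).α.length = q.α.length + n := by
  induction n with
  | zero => rfl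
  | succ n ih =>
    rw [Function.iterate_succ_apply', next_length_α, ih, add_assoc]

theorem rng_next (q : Quad A) : (q.next B).rng B = q.rng B := by
  refine Subtype.ext ?_
  change prepend (q.α.edges ++ [kappa B q.m (q.x.1 q.β.length)]) _ = prepend q.α.edges _
  rw [prepend_snoc]
  congr 1
  funext n
  cases n with
  | zero => rfl
  | succ n =>
    change kappa B (phiSeq B (phi B q.m (q.x.1 q.β.length)) _ n) _ =
      kappa B (phiSeq B q.m _ (n + 1)) _
    rw [phiSeq_succ']
    simp only [InfPath.drop, next, FinPath.length_snoc, add_assoc, add_comm 1, add_zero]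

theorem iterate_rng (q : Quad A) (n : ℕ) : ((next B)^[n] q).rng B = q.rng B := by
  induction n with
  | zero => rfl
  | succ n ih => rw [Function.iterate_succ_apply', rng_next, ih]

theorem rng_at (q : Quad A) : (q.rng B).1 q.α.length = kappa B q.m (q.x.1 q.β.length) :=
  prepend_add q.α.edges _ 0

theorem next_injective {B : Matrix V V ℤ} (h : PseudoFree A B) :
    Function.Injective (next (A := A) B) := by
  intro q q' hq
  have hx : q.x = q'.x := (congrArg Quad.x hq :)
  obtain ⟨h1, h2⟩ := FinPath.snoc_inj (e := kappa B q.m (q.x.1 q.β.length))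
    (e' := kappa B q'.m (q'.x.1 q'.β.length)) (h := q.src_next.trans q.rng_eq.symm)
    (h' := q'.src_next.trans q'.rng_eq.symm) (congrArg Quad.α hq)
  obtain ⟨h3, h4⟩ := FinPath.snoc_inj (h := q.src_next) (h' := q'.src_next) (congrArg Quad.β hq)
  have h5 : phi B q.m (q.x.1 q.β.length) = phi B q'.m (q'.x.1 q'.β.length) :=
    (congrArg Quad.m hq :)
  rw [← h4] at h2 h5
  exact Quad.ext h1 (h.eq_of_eq h2 h5) h3 hx

/-- The unit quadruple `(v, 0, v; x)`, where `v` is the source of `x`. -/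
def unit (x : InfPath A) : Quad A where
  α := .vertex x.src
  m := 0
  β := .vertex x.src
  x := x
  rng_eq := rfl
  mem := ⟨x, rfl, rfl⟩

/-- The inverse quadruple `(β, -m, α; α κ_m(y))`, where `x = βy`. -/
def inv (q : Quad A) : Quad A where
  α := q.β
  m := -q.m
  β := q.α
  x := q.rng B
  rng_eq := q.rng_eq.symm
  mem := q.rng_mem B

/-- The product `(α, m' + m, γ; γx)` of `(α, m', β; β κ_m(x))` and `(β, m, γ; γx)`. -/
def comp (q q' : Quad A) (h : q.β = q'.α) : Quad A where
  α := q.α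
  m := q.m + q'.m
  β := q'.β
  x := q'.x
  rng_eq := by rw [q.rng_eq, h, q'.rng_eq]
  mem := q'.mem

/-- The quadruples `q` and `q'` have the form `(α, m', β; β κ_m(x))` and `(β, m, γ; γx)`. -/
structure Matched (q q' : Quad A) : Prop where
  β_eq : q.β = q'.α
  x_eq : q.x = q'.rng B

end Quad

namespace Quad

theorem eq_of_length {q q' : Quad A} (hx : q.x = q'.x) (hr : q.rng B = q'.rng B) (hm : q.m = q'.m)
    (hα : q.α.length = q'.α.length) (hβ : q.β.length = q'.β.length) : q = q' :=
  Quad.ext (eq_of_mem_cylinder (q.rng_mem B) (hr ▸ q'.rng_mem B) hα) hm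
    (eq_of_mem_cylinder q.mem (hx ▸ q'.mem) hβ) hx

theorem rng_unit (x : InfPath A) : (unit x).rng B = x := by
  have h0 : x.drop 0 = x := Subtype.ext (funext fun n => congrArg x.1 (zero_add n))
  refine Subtype.ext ?_
  change (act B 0 (x.drop 0)).1 = x.1
  rw [h0, act_zero]

theorem iterate_unit (x : InfPath A) (n : ℕ) :
    ((next B)^[n] (unit x)).m = 0 ∧ ((next B)^[n] (unit x)).α = ((next B)^[n] (unit x)).β := by
  induction n with
  | zero => exact ⟨rfl, rfl⟩
  | succ n ih =>
    rw [Function.iterate_succ_apply']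
    set q := (next B)^[n] (unit x)
    obtain ⟨h1, h2⟩ := ih
    refine ⟨?_, FinPath.ext ?_ ?_⟩
    · simp only [next, h1, phi_zero]
    · exact (congrArg FinPath.src h2 :)
    · simp only [next, FinPath.snoc, h1, kappa_zero, h2]

theorem rng_inv (q : Quad A) : (q.inv B).rng B = q.x := by
  refine Subtype.ext ?_
  have h1 := append_drop_of_mem q.mem
  have h2 : (q.rng B).drop q.α.length = act B q.m (q.x.drop q.β.length) :=
    FinPath.drop_append _ _ _
  have h3 := congrArg Subtype.val h1
  rw [← h3]
  change prepend q.β.edges (act B (-q.m) ((q.rng B).drop q.α.length)).1 = _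
  rw [h2, ← act_add, neg_add_cancel, act_zero]
  rfl

theorem inv_next (q : Quad A) : (q.next B).inv B = (q.inv B).next B := by
  have h : (q.inv B).x.1 (q.inv B).β.length = kappa B q.m (q.x.1 q.β.length) := q.rng_at B
  refine Quad.ext ?_ ?_ ?_ (rng_next B q)
  · refine FinPath.ext rfl ?_
    simp only [inv, next, FinPath.snoc, rng_at, kappa_neg_kappa]
  · simp only [inv, next, rng_at, phi_neg_kappa]
  · refine FinPath.ext rfl ?_
    simp only [inv, next, FinPath.snoc, rng_at]

theorem Matched.next {q q' : Quad A} (h : q.Matched B q') :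
    (q.next B).Matched B (q'.next B) := by
  have h1 : q.x.1 q.β.length = kappa B q'.m (q'.x.1 q'.β.length) := by
    rw [h.1, h.2, rng_at]
  refine ⟨FinPath.ext (congrArg FinPath.src h.1 :) ?_, ?_⟩
  · simp only [Quad.next, FinPath.snoc, h1]
    rw [h.1]
  · rw [rng_next]
    exact h.2

theorem comp_next {q q' : Quad A} (h : q.Matched B q') :
    (q.comp q' h.1).next B = (q.next B).comp (q'.next B) h.next.1 := by
  have h1 : q.x.1 q.β.length = kappa B q'.m (q'.x.1 q'.β.length) := by
    rw [h.1, h.2, rng_at]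
  refine Quad.ext (FinPath.ext rfl ?_) ?_ rfl rfl
  · simp only [Quad.next, FinPath.snoc, comp, h1, kappa_add]
  · simp only [Quad.next, comp, h1, phi_add]

theorem Matched.iterate {q q' : Quad A} (h : q.Matched B q') (n : ℕ) :
    ((Quad.next B)^[n] q).Matched B ((Quad.next B)^[n] q') := by
  induction n with
  | zero => exact h
  | succ n ih =>
    rw [Function.iterate_succ_apply', Function.iterate_succ_apply']
    exact ih.next

theorem comp_iterate {q q' : Quad A} (h : q.Matched B q') (n : ℕ) :
    (Quad.next B)^[n] (q.comp q' h.1) =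
      ((Quad.next B)^[n] q).comp ((Quad.next B)^[n] q') (h.iterate B n).1 := by
  induction n with
  | zero => rfl
  | succ n ih =>
    rw [Function.iterate_succ_apply', ih, comp_next B (h.iterate B n)]
    simp only [Function.iterate_succ_apply']

theorem comp_congr {p p' q q' : Quad A} (hp : p = p') (hq : q = q') (h : p.β = q.α)
    (h' : p'.β = q'.α) : p.comp q h = p'.comp q' h' := by
  subst hp hq
  rfl

theorem exists_matched {q q' : Quad A} (h : q.x = q'.rng B) :
    ((next B)^[q'.α.length] q).Matched B ((next B)^[q.β.length] q') := by
  have hr : ((next B)^[q'.α.length] q).x = ((next B)^[q.β.length] q').rng B := by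
    rw [iterate_x, iterate_rng, h]
  refine ⟨eq_of_mem_cylinder (mem _) (hr ▸ rng_mem B _) ?_, hr⟩
  rw [iterate_length_α, iterate_length_β, add_comm]

end Quad

theorem mk_comp_eq {p p' q q' : Quad A} (h : p.Matched B q) (h' : p'.Matched B q')
    (hp : mk B p = mk B p') (hq : mk B q = mk B q') :
    mk B (p.comp q h.1) = mk B (p'.comp q' h'.1) := by
  obtain ⟨a, a', ha⟩ := (mk_eq_iff B p p').1 hp
  obtain ⟨b, b', hb⟩ := (mk_eq_iff B q q').1 hq
  have h1 := congrArg (fun r => r.β.length) ha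
  have h2 := congrArg (fun r => r.α.length) hb
  simp only [Quad.iterate_length_α, Quad.iterate_length_β] at h1 h2
  rw [h.1, h'.1] at h1
  have h3 : b + a' = a + b' := by omega
  refine (mk_eq_iff B _ _).2 ⟨b + a, b + a', ?_⟩
  rw [Quad.comp_iterate B h, Quad.comp_iterate B h']
  refine Quad.comp_congr ?_ ?_ _ _
  · rw [Function.iterate_add_apply, ha, ← Function.iterate_add_apply]
  · rw [h3, add_comm b a, Function.iterate_add_apply, hb, ← Function.iterate_add_apply]


namespace Arrow

variable {B}

/-- The source `s [α, m, β; x] = x`. -/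
def src : Arrow A B → InfPath A :=
  Quot.lift Quad.x fun q q' h => by rw [(step_iff B q q').1 h]; rfl

/-- The range `r [α, m, β; βy] = α κ_m(y)`. -/
def rng : Arrow A B → InfPath A :=
  Quot.lift (Quad.rng B) fun q q' h => by rw [(step_iff B q q').1 h, Quad.rng_next]

/-- The inverse `[α, m, β; βy]⁻¹ = [β, -m, α; α κ_m(y)]`. -/
def inv : Arrow A B → Arrow A B :=
  Quot.lift (fun q => mk B (q.inv B)) fun q q' h => by
    rw [(step_iff B q q').1 h, Quad.inv_next, mk_next]

/-- The unit `[v, 0, v; x]` at `x`, where `v` is the source of `x`. -/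
def one (x : InfPath A) : Arrow A B := mk B (Quad.unit x)

/-- The relation `k = g h` given by the formula
`[α, m', β; β κ_m(x)] [β, m, γ; γx] = [α, m' + m, γ; γx]`. -/
def IsMul (g h k : Arrow A B) : Prop :=
  ∃ (p q : Quad A) (hpq : p.Matched B q), mk B p = g ∧ mk B q = h ∧ mk B (p.comp q hpq.1) = k

theorem exists_isMul (g h : Arrow A B) (hgh : g.src = h.rng) : ∃ k, IsMul g h k := by
  induction g using Quot.ind with | mk p => ?_
  induction h using Quot.ind with | mk q => ?_
  exact ⟨_, _, _, Quad.exists_matched B hgh, mk_iterate_next B p _, mk_iterate_next B q _, rfl⟩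

open scoped Classical in
/-- The product `g h` of two arrows with `s(g) = r(h)`; the value on other pairs is irrelevant. -/
noncomputable def mul (g h : Arrow A B) : Arrow A B :=
  if hgh : g.src = h.rng then (exists_isMul g h hgh).choose else g

theorem mul_mk {p q : Quad A} (h : p.Matched B q) :
    mul (mk B p) (mk B q) = mk B (p.comp q h.1) := by
  have h' : (mk B p).src = (mk B q).rng := h.2
  rw [mul, dif_pos h']
  obtain ⟨p', q', hpq, h1, h2, h3⟩ := (exists_isMul _ _ h').choose_spec
  rw [← h3]
  exact mk_comp_eq B hpq h h1 h2

theorem exists_rep (g h : Arrow A B) (hgh : g.src = h.rng) :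
    ∃ p q : Quad A, p.Matched B q ∧ mk B p = g ∧ mk B q = h := by
  obtain ⟨_, p, q, h1, h2, h3, -⟩ := exists_isMul g h hgh
  exact ⟨p, q, h1, h2, h3⟩

theorem rng_comp {p q : Quad A} (h : p.Matched B q) : (p.comp q h.1).rng B = p.rng B := by
  refine Subtype.ext ?_
  change prepend p.α.edges (act B (p.m + q.m) (q.x.drop q.β.length)).1 =
    prepend p.α.edges (act B p.m (p.x.drop p.β.length)).1
  have h1 : (q.rng B).drop q.α.length = act B q.m (q.x.drop q.β.length) :=
    FinPath.drop_append _ _ _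
  rw [h.1, h.2, h1, act_add]

theorem src_mul (g h : Arrow A B) (hgh : g.src = h.rng) : (mul g h).src = h.src := by
  obtain ⟨p, q, hpq, rfl, rfl⟩ := exists_rep g h hgh
  rw [mul_mk hpq]
  rfl

theorem rng_mul (g h : Arrow A B) (hgh : g.src = h.rng) : (mul g h).rng = g.rng := by
  obtain ⟨p, q, hpq, rfl, rfl⟩ := exists_rep g h hgh
  rw [mul_mk hpq]
  exact rng_comp hpq

theorem mul_assoc (g h k : Arrow A B) (hgh : g.src = h.rng) (hhk : h.src = k.rng) :
    mul (mul g h) k = mul g (mul h k) := by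
  obtain ⟨p, q, hpq, hp, hq⟩ := exists_rep g h hgh
  obtain ⟨q', r, hqr, hq', hr⟩ := exists_rep h k hhk
  obtain ⟨a, b, hab⟩ := (mk_eq_iff B q q').1 (hq.trans hq'.symm)
  have h1 := hpq.iterate B a
  have h2 := hqr.iterate B b
  rw [← mk_iterate_next B p a] at hp
  rw [← mk_iterate_next B q a, hab] at hq
  rw [← mk_iterate_next B r b] at hr
  rw [hab] at h1
  subst hp hq hr
  rw [mul_mk h1, mul_mk h2,
    mul_mk (p := ((Quad.next B)^[a] p).comp _ h1.1) (q := (Quad.next B)^[b] r) ⟨h2.1, h2.2⟩,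
    mul_mk (p := (Quad.next B)^[a] p) (q := ((Quad.next B)^[b] q').comp _ h2.1)
      ⟨h1.1, h1.2.trans (rng_comp h2).symm⟩]
  congr 1
  exact Quad.ext rfl (_root_.add_assoc _ _ _) rfl rfl

theorem mk_eq_one {q : Quad A} (h : q.α = q.β) (hm : q.m = 0) : mk B q = one q.x := by
  have h1 := Quad.iterate_unit B q.x q.β.length
  have h2 : (Quad.next B)^[q.β.length] (Quad.unit q.x) = q := by
    have h3 : ((Quad.next B)^[q.β.length] (Quad.unit q.x)).β = q.β := by
      refine eq_of_mem_cylinder (Quad.mem _) ?_ ?_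
      · rw [Quad.iterate_x]; exact q.mem
      · rw [Quad.iterate_length_β]; exact zero_add _
    refine Quad.ext (h1.2.trans (h3.trans h.symm)) (h1.1.trans hm.symm) h3 ?_
    rw [Quad.iterate_x]
    rfl
  rw [one, ← mk_iterate_next B (Quad.unit q.x) q.β.length, h2]

theorem inv_mul (g : Arrow A B) : mul (inv g) g = one g.src := by
  induction g using Quot.ind with | mk q => ?_
  have h : (q.inv B).Matched B q := ⟨rfl, rfl⟩
  refine (mul_mk h).trans ?_
  exact mk_eq_one (q := (q.inv B).comp q h.1) rfl (neg_add_cancel q.m)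

theorem inv_inv (g : Arrow A B) : inv (inv g) = g := by
  induction g using Quot.ind with | mk q => ?_
  refine congrArg (mk B) (Quad.ext rfl (neg_neg q.m) rfl (Quad.rng_inv B q))

theorem src_inv (g : Arrow A B) : (inv g).src = g.rng := by
  induction g using Quot.ind with | mk q => rfl

theorem rng_inv (g : Arrow A B) : (inv g).rng = g.src := by
  rw [← src_inv, inv_inv]

theorem mul_inv (g : Arrow A B) : mul g (inv g) = one g.rng := by
  have h := inv_mul (inv g)
  rwa [inv_inv, src_inv] at h

theorem src_one (x : InfPath A) : (one x : Arrow A B).src = x := rfl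

theorem rng_one (x : InfPath A) : (one x : Arrow A B).rng = x := Quad.rng_unit B x

theorem one_mul (g : Arrow A B) : mul (one g.rng) g = g := by
  induction g using Quot.ind with | mk q => ?_
  let p : Quad A := ⟨q.α, 0, q.α, q.rng B, rfl, q.rng_mem B⟩
  have h : p.Matched B q := ⟨rfl, rfl⟩
  have h1 : mk B p = one (q.rng B) := mk_eq_one (q := p) rfl rfl
  have h2 := mul_mk h
  rw [h1] at h2
  exact h2.trans (congrArg (mk B) (Quad.ext rfl (zero_add _) rfl rfl))

theorem mul_one (g : Arrow A B) : mul g (one g.src) = g := by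
  rw [← inv_mul, ← mul_assoc g (inv g) g (rng_inv g).symm (src_inv g), mul_inv, one_mul]

/-- The degree `[α, m, β; x] ↦ |α| - |β|`. -/
def degree : Arrow A B → ℤ :=
  Quot.lift (fun q => (q.α.length : ℤ) - q.β.length) fun q q' h => by
    rw [(step_iff B q q').1 h]
    simp only [Quad.next_length_α, Quad.next_length_β]
    omega

theorem degree_mul (g h : Arrow A B) (hgh : g.src = h.rng) :
    (mul g h).degree = g.degree + h.degree := by
  obtain ⟨p, q, hpq, rfl, rfl⟩ := exists_rep g h hgh
  rw [mul_mk hpq]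
  change (p.α.length : ℤ) - q.β.length =
    (p.α.length - p.β.length) + (q.α.length - q.β.length)
  rw [hpq.1]
  omega

/-- The set `Z(α, m, β; Z(β))` of the classes `[α, m, β; x]` with `x ∈ Z(β)`. -/
def cyl (α : FinPath A) (m : ℤ) (β : FinPath A) : Set (Arrow A B) :=
  {g | ∃ q : Quad A, q.α = α ∧ q.m = m ∧ q.β = β ∧ mk B q = g}

/-- The topology with the sets `Z(α, m, β; Z(β))` as a basis. -/
instance : TopologicalSpace (Arrow A B) :=
  .generateFrom {s | ∃ α m β, s = cyl α m β}

/-- The set `Z(α, m, β; Z(β))` given by the entries of a quadruple. -/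
def nbhd (B : Matrix V V ℤ) (q : Quad A) : Set (Arrow A B) := cyl q.α q.m q.β

theorem isOpen_nbhd (q : Quad A) : IsOpen (nbhd B q) :=
  TopologicalSpace.isOpen_generateFrom_of_mem ⟨_, _, _, rfl⟩

theorem mem_nbhd (q : Quad A) : mk B q ∈ nbhd B q := ⟨q, rfl, rfl, rfl, rfl⟩

theorem nbhd_next (q : Quad A) : nbhd B (q.next B) ⊆ nbhd B q := by
  rintro _ ⟨p, h1, h2, h3, rfl⟩
  have h4 := mem_cylinder_of_snoc (h := q.src_next) (h3 ▸ p.mem : p.x ∈ cylinder (q.next B).β)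
  let p' : Quad A := ⟨q.α, q.m, q.β, p.x, q.rng_eq, h4.1⟩
  refine ⟨p', rfl, rfl, rfl, ?_⟩
  rw [← mk_next]
  congr 1
  refine Quad.ext ?_ ?_ ?_ rfl
  · rw [h1]; simp only [Quad.next, p', h4.2]
  · rw [h2]; simp only [Quad.next, p', h4.2]
  · rw [h3]; simp only [Quad.next, p', h4.2]

theorem nbhd_iterate_anti (q : Quad A) {a b : ℕ} (h : a ≤ b) :
    nbhd B ((Quad.next B)^[b] q) ⊆ nbhd B ((Quad.next B)^[a] q) := by
  induction h with
  | refl => exact subset_rfl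
  | step _ ih => rw [Function.iterate_succ_apply']; exact (nbhd_next _).trans ih

theorem exists_nbhd_subset {U : Set (Arrow A B)} (hU : IsOpen U) {q : Quad A} (hq : mk B q ∈ U) :
    ∃ a, nbhd B ((Quad.next B)^[a] q) ⊆ U := by
  induction hU with
  | basic s hs =>
    obtain ⟨α, m, β, rfl⟩ := hs
    obtain ⟨p, rfl, rfl, rfl, h⟩ := hq
    obtain ⟨a, b, hab⟩ := (mk_eq_iff B p q).1 h
    exact ⟨b, hab ▸ nbhd_iterate_anti p (Nat.zero_le a)⟩
  | univ => exact ⟨0, Set.subset_univ _⟩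
  | inter s t _ _ ihs iht =>
    obtain ⟨a, ha⟩ := ihs hq.1
    obtain ⟨b, hb⟩ := iht hq.2
    exact ⟨max a b, Set.subset_inter ((nbhd_iterate_anti q (le_max_left a b)).trans ha)
      ((nbhd_iterate_anti q (le_max_right a b)).trans hb)⟩
  | sUnion S _ ih =>
    obtain ⟨s, hs, hqs⟩ := hq
    obtain ⟨a, ha⟩ := ih s hs hqs
    exact ⟨a, ha.trans (Set.subset_sUnion_of_mem hs)⟩

theorem continuous_src : Continuous (src : Arrow A B → InfPath A) := by
  refine ⟨fun W hW => isOpen_iff_forall_mem_open.2 fun g hg => ?_⟩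
  induction g using Quot.ind with | mk q => ?_
  obtain ⟨n, hn⟩ := exists_agree_subset hW hg
  refine ⟨_, ?_, isOpen_nbhd ((Quad.next B)^[n] q), ?_⟩
  · rintro _ ⟨p, -, -, h3, rfl⟩
    refine hn p.x fun i hi => ?_
    refine agree_of_mem_cylinder (α := p.β) ?_ p.mem i ?_
    · have := ((Quad.next B)^[n] q).mem
      rw [← h3, Quad.iterate_x] at this
      exact this
    · rw [h3, Quad.iterate_length_β]
      omega
  · have := mem_nbhd (B := B) ((Quad.next B)^[n] q)
    rwa [mk_iterate_next] at this

theorem isOpenMap_src : IsOpenMap (src : Arrow A B → InfPath A) := by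
  intro U hU
  refine isOpen_iff_forall_mem_open.2 ?_
  rintro _ ⟨g, hg, rfl⟩
  induction g using Quot.ind with | mk q => ?_
  obtain ⟨a, ha⟩ := exists_nbhd_subset hU hg
  set p := (Quad.next B)^[a] q with hp
  refine ⟨cylinder p.β, fun x hx => ?_, isOpen_cylinder _, ?_⟩
  · exact ⟨mk B ⟨p.α, p.m, p.β, x, p.rng_eq, hx⟩,
      ha ⟨⟨p.α, p.m, p.β, x, p.rng_eq, hx⟩, rfl, rfl, rfl, rfl⟩, rfl⟩
  · have : p.x = q.x := Quad.iterate_x B q a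
    change q.x ∈ _
    rw [← this]
    exact p.mem

theorem isLocalHomeomorph_src : IsLocalHomeomorph (src : Arrow A B → InfPath A) := by
  refine isLocalHomeomorph_of_locallyInjective_of_isOpenMap continuous_src isOpenMap_src fun g => ?_
  induction g using Quot.ind with | mk q => ?_
  refine ⟨nbhd B q, isOpen_nbhd q, mem_nbhd q, ?_⟩
  rintro _ ⟨p, h1, h2, h3, rfl⟩ _ ⟨p', h1', h2', h3', rfl⟩ h
  rw [Quad.ext (h1.trans h1'.symm) (h2.trans h2'.symm) (h3.trans h3'.symm) h]

theorem continuous_inv : Continuous (inv : Arrow A B → Arrow A B) := by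
  refine continuous_generateFrom_iff.2 ?_
  rintro _ ⟨α, m, β, rfl⟩
  have h : inv ⁻¹' (cyl α m β : Set (Arrow A B)) = cyl β (-m) α := by
    ext g
    constructor
    · rintro ⟨q, rfl, rfl, rfl, h⟩
      exact ⟨q.inv B, rfl, rfl, rfl, by rw [← inv_inv g, ← h]; rfl⟩
    · rintro ⟨q, rfl, h, rfl, rfl⟩
      exact ⟨q.inv B, rfl, by rw [← neg_neg m, ← h]; rfl, rfl, rfl⟩
  rw [h]
  exact TopologicalSpace.isOpen_generateFrom_of_mem ⟨_, _, _, rfl⟩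

theorem isLocalHomeomorph_rng : IsLocalHomeomorph (rng : Arrow A B → InfPath A) := by
  have h : (rng : Arrow A B → InfPath A) = src ∘ inv := funext fun g => (src_inv g).symm
  let e : Arrow A B ≃ₜ Arrow A B := ⟨⟨inv, inv, inv_inv, inv_inv⟩, continuous_inv, continuous_inv⟩
  rw [h]
  exact isLocalHomeomorph_src.comp e.isLocalHomeomorph

theorem continuous_one : Continuous (one : InfPath A → Arrow A B) := by
  refine ⟨fun U hU => isOpen_iff_forall_mem_open.2 fun x hx => ?_⟩
  obtain ⟨a, ha⟩ := exists_nbhd_subset hU hx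
  set p := (Quad.next B)^[a] (Quad.unit x) with hp
  have h := Quad.iterate_unit B x a
  rw [← hp] at h
  refine ⟨cylinder p.β, fun z hz => ha ?_, isOpen_cylinder _, ?_⟩
  · exact ⟨⟨p.β, 0, p.β, z, rfl, hz⟩, h.2.symm, h.1.symm, rfl, mk_eq_one rfl rfl⟩
  · have : p.x = x := Quad.iterate_x B _ a
    have h' := p.mem
    rwa [this] at h'

theorem continuous_mul : Continuous fun p : {p : Arrow A B × Arrow A B // p.1.src = p.2.rng} =>
    mul p.1.1 p.1.2 := by
  refine ⟨fun U hU => isOpen_iff_forall_mem_open.2 ?_⟩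
  rintro ⟨⟨g, h⟩, hgh⟩ hU'
  obtain ⟨p, q, hpq, rfl, rfl⟩ := exists_rep g h hgh
  replace hU' : mul (mk B p) (mk B q) ∈ U := hU'
  rw [mul_mk hpq] at hU'
  obtain ⟨a, ha⟩ := exists_nbhd_subset hU hU'
  rw [Quad.comp_iterate B hpq] at ha
  refine ⟨Subtype.val ⁻¹' (nbhd B ((Quad.next B)^[a] p) ×ˢ nbhd B ((Quad.next B)^[a] q)), ?_,
    ((isOpen_nbhd _).prod (isOpen_nbhd _)).preimage continuous_subtype_val, ?_⟩
  · rintro ⟨⟨_, _⟩, h⟩ ⟨⟨p', h1, h2, h3, rfl⟩, ⟨q', h4, h5, h6, rfl⟩⟩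
    have hm : p'.Matched B q' := ⟨by rw [h3, h4]; exact (hpq.iterate B a).1, h⟩
    change mul (mk B p') (mk B q') ∈ U
    rw [mul_mk hm]
    exact ha ⟨p'.comp q' hm.1, h1, congrArg₂ (· + ·) h2 h5, h6, rfl⟩
  · constructor
    · have := mem_nbhd (B := B) ((Quad.next B)^[a] p)
      rwa [mk_iterate_next] at this
    · have := mem_nbhd (B := B) ((Quad.next B)^[a] q)
      rwa [mk_iterate_next] at this

theorem continuous_degree : Continuous (degree : Arrow A B → ℤ) := by
  refine continuous_discrete_rng.2 fun n => isOpen_iff_forall_mem_open.2 fun g hg => ?_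
  induction g using Quot.ind with | mk q => ?_
  refine ⟨nbhd B q, ?_, isOpen_nbhd q, mem_nbhd q⟩
  rintro _ ⟨p, h1, h2, h3, rfl⟩
  change (p.α.length : ℤ) - p.β.length = n
  rw [h1, h3]
  exact hg

theorem t2Space (hAB : PseudoFree A B) : T2Space (Arrow A B) := by
  refine ⟨fun g g' hne => ?_⟩
  by_cases hs : g.src = g'.src
  · obtain ⟨q, rfl⟩ : ∃ q, mk B q = g := Quot.exists_rep g
    obtain ⟨q', rfl⟩ : ∃ q', mk B q' = g' := Quot.exists_rep g'
    replace hs : q.x = q'.x := hs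
    rw [← mk_iterate_next B q q'.β.length, ← mk_iterate_next B q' q.β.length] at hne ⊢
    set p := (Quad.next B)^[q'.β.length] q with hp
    set p' := (Quad.next B)^[q.β.length] q' with hp'
    have hx : p.x = p'.x := by rw [hp, hp', Quad.iterate_x, Quad.iterate_x, hs]
    have hl : p.β.length = p'.β.length := by
      rw [hp, hp', Quad.iterate_length_β, Quad.iterate_length_β, add_comm]
    refine ⟨nbhd B p, nbhd B p', isOpen_nbhd _, isOpen_nbhd _, mem_nbhd _, mem_nbhd _, ?_⟩
    rw [Set.disjoint_left]
    rintro _ ⟨r, h1, h2, h3, rfl⟩ ⟨r', h1', h2', h3', h⟩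
    obtain ⟨a, b, hab⟩ := (mk_eq_iff B r' r).1 h
    have h4 := congrArg (fun s => s.β.length) hab
    simp only [Quad.iterate_length_β, h3, h3', hl] at h4
    obtain rfl : a = b := by omega
    have h5 : r' = r := (Quad.next_injective hAB).iterate a hab
    subst h5
    exact hne (congrArg (mk B) (Quad.ext (h1.symm.trans h1') (h2.symm.trans h2')
      (h3.symm.trans h3') hx))
  · exact separated_by_continuous continuous_src hs

end Arrow

variable {B}

/-- The Katsura–Exel–Pardo groupoid of a pseudo free pair of matrices. -/
noncomputable def groupoid (hAB : PseudoFree A B) : EtaleGroupoid.{u} where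
  Obj := InfPath A
  Arr := Arrow A B
  t2Arr := Arrow.t2Space hAB
  src := Arrow.src
  rng := Arrow.rng
  one := Arrow.one
  inv := Arrow.inv
  mul := Arrow.mul
  src_one := Arrow.src_one
  rng_one := Arrow.rng_one
  src_inv := Arrow.src_inv
  rng_inv := Arrow.rng_inv
  src_mul := Arrow.src_mul
  rng_mul := Arrow.rng_mul
  mul_assoc := Arrow.mul_assoc
  one_mul := Arrow.one_mul
  mul_one := Arrow.mul_one
  inv_mul := Arrow.inv_mul
  mul_inv := Arrow.mul_inv
  continuous_one := Arrow.continuous_one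
  continuous_inv := Arrow.continuous_inv
  continuous_mul := Arrow.continuous_mul
  isLocalHomeomorph_src := Arrow.isLocalHomeomorph_src
  isLocalHomeomorph_rng := Arrow.isLocalHomeomorph_rng

/-- The homomorphism `ρ : [α, m, β; x] ↦ |α| - |β|`. -/
noncomputable def rho (hAB : PseudoFree A B) : (groupoid hAB).IntHom where
  toFun := Arrow.degree
  map_mul := Arrow.degree_mul
  continuous_toFun := Arrow.continuous_degree

/-- The groupoid `H_{A,B} = ker ρ`. -/
noncomputable def kernelGroupoid (hAB : PseudoFree A B) : EtaleGroupoid.{u} := (rho hAB).ker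

end Katsura

/-! The kernel groupoid is the increasing union of open subgroupoids `H_N` formed by the classes
`[α, m, β; x]` with `|α| = |β| = N`. A compactly supported chain in positive degree meets only
strings from one `H_N`, so it suffices that every cycle of degree at least two in `H_N` is a
boundary there.

Inside `H_N` the group `ℤ` is in control. Pseudo freeness makes the integer `m` of such a class well
defined, and `[α, m, β; x] ↦ m` is a continuous homomorphism to `ℤ`. Fix, for each vertex that ends
some path of length `N`, one such path `μ`, and put `sec k x = [μ, k, β; x]`, where `β` is the
initial segment of `x` of length `N` and `μ` ends where `β` does. The arrows `sec k x` move
everything into the cylinders of the chosen paths, where only the classes `[μ, m, μ; x]` remain,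
that is, an action of `ℤ`. Since `ℤ` has homological dimension one, no homology is left from degree
two on.

This is made explicit by a contracting homotopy, valid for any groupoid with a `TranslationSection`.
Let `E k` put `sec k` in front of a string. Then `E 0` fails to be a contraction because the face
`d_1` turns `E 0` into `E m` on strings whose first entry has degree `m`. The difference `E 0 - E m`
telescopes into terms `E k - E (k + 1)`, and each of them is, up to correction terms, the boundary
of the operator `T k` that puts both `shift k` and `sec k` in front. Subtracting the sum of the `T
k` applied to `d_0` repairs `E 0`.

The weight is carried by `boundary_extendPush` and `boundary_extendTwoPush` (the two boundary
formulas), `boundary_homotopy_add_of_deg` (the homotopy identity),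
`subsingleton_homology_of_translationSection` (passage to the union), and `levelDeg_mul` with
`levelSection_mul` (the translation section of `H_N`). -/

/-! ### Further properties of the push-forward -/

section PushforwardLemmas

variable {X Y : Type*} [TopologicalSpace X] [TopologicalSpace Y] [T2Space X] [T2Space Y]

/-- Only points where `f` is nonzero contribute to the fibre sums. The weak hypothesis is needed for
face identities that hold only for strings with a prescribed degree of the first entry. -/
theorem pushforward_congr {π τ : X → Y} (hπ : IsLocalHomeomorph π) (hτ : IsLocalHomeomorph τ)
    {f : C_c(X, ℤ)} (h : ∀ x, f x ≠ 0 → π x = τ x) : pushforward π hπ f = pushforward τ hτ f := by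
  ext y
  rw [pushforward_apply, pushforward_apply]
  refine finsum_congr fun x => ?_
  by_cases hx : f x = 0
  · simp [hx]
  · simp only [Set.mem_preimage, h x hx]

theorem pushforward_apply_of_injective {π : X → Y} (hπ : IsLocalHomeomorph π)
    (hi : Function.Injective π) (f : C_c(X, ℤ)) (x : X) : pushforward π hπ f (π x) = f x := by
  rw [pushforward_apply]
  have h : π ⁻¹' {π x} = {x} := by
    ext z
    simp [hi.eq_iff]
  rw [h, finsum_mem_singleton]

theorem pushforward_injective {π : X → Y} (hπ : IsLocalHomeomorph π)
    (hi : Function.Injective π) : Function.Injective (pushforward π hπ) := by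
  intro f g hfg
  ext x
  rw [← pushforward_apply_of_injective hπ hi, hfg, pushforward_apply_of_injective hπ hi]

theorem pushforward_of_forall_eq {π : X → X} (hπ : IsLocalHomeomorph π) (h : ∀ x, π x = x)
    (f : C_c(X, ℤ)) : pushforward π hπ f = f := by
  obtain rfl : π = id := funext h
  ext x
  exact pushforward_apply_of_injective hπ Function.injective_id f x

theorem exists_of_pushforward_ne_zero {π : X → Y} (hπ : IsLocalHomeomorph π) {f : C_c(X, ℤ)}
    {y : Y} (hy : pushforward π hπ f y ≠ 0) : ∃ x, π x = y ∧ f x ≠ 0 := by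
  by_contra! h
  exact hy (finsum_mem_eq_zero_of_forall_eq_zero fun x hx => h x hx)

end PushforwardLemmas

/-! ### Restriction to the fibres of a locally constant function -/

section FiberRestrict

variable {X : Type*} [TopologicalSpace X]

/-- The product of `f` and the indicator function of the clopen set `p = m`. -/
def fiberRestrict (p : X → ℤ) (hp : Continuous p) (m : ℤ) : C_c(X, ℤ) →+ C_c(X, ℤ) where
  toFun f :=
    { toFun := fun x => if p x = m then f x else 0
      continuous_toFun := (continuous_of_discreteTopology
        (f := fun q : ℤ × ℤ => if q.1 = m then q.2 else 0)).comp (hp.prodMk f.continuous)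
      hasCompactSupport' := by
        refine f.hasCompactSupport.mono fun x hx => ?_
        rw [Function.mem_support] at hx ⊢
        exact fun h => hx (by simp [h]) }
  map_zero' := by
    ext x
    change (if p x = m then (0 : ℤ) else 0) = 0
    simp
  map_add' f g := by
    ext x
    change (if p x = m then f x + g x else 0) =
      (if p x = m then f x else 0) + (if p x = m then g x else 0)
    split_ifs <;> simp

variable {p : X → ℤ} (hp : Continuous p)

theorem fiberRestrict_apply (m : ℤ) (f : C_c(X, ℤ)) (x : X) :
    fiberRestrict p hp m f x = if p x = m then f x else 0 := rfl

theorem fiberRestrict_eq_self {m : ℤ} {f : C_c(X, ℤ)} (h : ∀ x, f x ≠ 0 → p x = m) :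
    fiberRestrict p hp m f = f := by
  ext x
  rw [fiberRestrict_apply]
  split_ifs with h1
  · rfl
  · by_contra h2
    exact h1 (h x (Ne.symm h2))

theorem fiberRestrict_eq_zero {m m' : ℤ} (hm : m ≠ m') {f : C_c(X, ℤ)}
    (h : ∀ x, f x ≠ 0 → p x = m) : fiberRestrict p hp m' f = 0 := by
  ext x
  rw [fiberRestrict_apply]
  split_ifs with h1
  · by_contra h2
    exact hm ((h x h2).symm.trans h1)
  · rfl

theorem sum_fiberRestrict {f : C_c(X, ℤ)} {F : Finset ℤ} (h : ∀ x, f x ≠ 0 → p x ∈ F) :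
    ∑ m ∈ F, fiberRestrict p hp m f = f := by
  ext x
  rw [CompactlySupportedContinuousMap.sum_apply]
  simp only [fiberRestrict_apply]
  rw [Finset.sum_ite_eq]
  split_ifs with h1
  · rfl
  · by_contra h2
    exact h1 (h x (Ne.symm h2))

/-- An integer-valued continuous function is bounded on a compact support, so a chain has only
finitely many nonzero pieces under `fiberRestrict`. -/
theorem exists_abs_le {p : X → ℤ} (hp : Continuous p) (f : C_c(X, ℤ)) :
    ∃ N : ℤ, ∀ x, f x ≠ 0 → |p x| ≤ N := by
  obtain ⟨C, hC⟩ := f.hasCompactSupport.isCompact.exists_bound_of_continuousOn hp.continuousOn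
  refine ⟨⌈C⌉, fun x hx => ?_⟩
  have h := hC x (subset_tsupport f hx)
  rw [Int.norm_eq_abs] at h
  exact_mod_cast h.trans (Int.le_ceil C)

end FiberRestrict

/-! ### Signed sums -/

section SignedSum

variable {M Q : Type*} [AddCommGroup M] [AddCommGroup Q]

/-- The sum of `F 0, …, F (m - 1)` for `m ≥ 0`, and minus the sum of `F m, …, F (-1)` for
`m ≤ 0`. -/
noncomputable def signedSum (F : ℤ → M) (m : ℤ) : M :=
  ∑ k ∈ Finset.Ico 0 m, F k - ∑ k ∈ Finset.Ico m 0, F k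

theorem signedSum_zero (F : ℤ → M) : signedSum F 0 = 0 := by simp [signedSum]

theorem signedSum_add_one (F : ℤ → M) (m : ℤ) : signedSum F (m + 1) = signedSum F m + F m := by
  unfold signedSum
  rcases le_or_gt 0 m with h | h
  · rw [Finset.Ico_eq_empty_of_le h, Finset.Ico_eq_empty_of_le (by omega : (0 : ℤ) ≤ m + 1),
      ← Finset.insert_Ico_right_eq_Ico_add_one h, Finset.sum_insert (by simp)]
    simp only [Finset.sum_empty, sub_zero]
    rw [add_comm]
  · rw [Finset.Ico_eq_empty_of_le h.le, Finset.Ico_eq_empty_of_le (by omega : m + 1 ≤ 0),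
      ← Finset.insert_Ico_add_one_left_eq_Ico h, Finset.sum_insert (by simp)]
    simp

/-- A function on `ℤ` is determined by its value at `0` and its increments. The telescoping and
shift rules follow from this without a case distinction on the sign of `m`. -/
theorem eq_signedSum {F G : ℤ → M} (h0 : G 0 = 0) (h : ∀ m, G (m + 1) = G m + F m) (m : ℤ) :
    G m = signedSum F m := by
  induction m using Int.induction_on with
  | zero => rw [h0, signedSum_zero]
  | succ n ih => rw [h, ih, signedSum_add_one]
  | pred n ih =>
    have h1 := h (-n - 1)
    have h2 := signedSum_add_one F (-n - 1)
    rw [sub_add_cancel] at h1 h2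
    rw [h1, h2] at ih
    exact add_right_cancel ih

theorem signedSum_sub_succ (F : ℤ → M) (m : ℤ) :
    signedSum (fun k => F k - F (k + 1)) m = F 0 - F m :=
  (eq_signedSum (F := fun k => F k - F (k + 1)) (G := fun m => F 0 - F m) (sub_self _)
    (fun m => by abel) m).symm

/-- As functions of `m`, both sides vanish at `0` and have increment `F (m + n)`. This rule is what
matches the degree `m₁ + m₂` of a product with the degrees of its factors in the homotopy identity.
-/
theorem signedSum_shift (F : ℤ → M) (m n : ℤ) :
    signedSum (fun k => F (k + n)) m = signedSum F (m + n) - signedSum F n :=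
  (eq_signedSum (F := fun k => F (k + n)) (G := fun m => signedSum F (m + n) - signedSum F n)
    (by simp) (fun m => by
      simp only [add_right_comm m 1 n, signedSum_add_one]
      abel) m).symm

theorem signedSum_add (F G : ℤ → M) (m : ℤ) :
    signedSum (fun k => F k + G k) m = signedSum F m + signedSum G m := by
  simp only [signedSum, Finset.sum_add_distrib]
  abel

theorem map_signedSum (φ : M →+ Q) (F : ℤ → M) (m : ℤ) :
    φ (signedSum F m) = signedSum (fun k => φ (F k)) m := by
  simp only [signedSum, map_sub, map_sum]

theorem signedSum_apply (F : ℤ → M →+ Q) (m : ℤ) (x : M) :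
    signedSum F m x = signedSum (fun k => F k x) m := by
  simp only [signedSum, AddMonoidHom.sub_apply, AddMonoidHom.finsetSum_apply]

end SignedSum

namespace EtaleGroupoid

variable {G : EtaleGroupoid.{u}}

/-! ### Strings with an arrow added in front -/

/-- The string `(g, g_1, …, g_n)`. -/
def cons : {n : ℕ} → (g : G.Arr) → (s : G.Strings n) → G.src g = G.firstUnit n s →
    G.Strings (n + 1)
  | 0, g, _, _ => ⟨fun _ => g, fun i => i.elim0⟩
  | n + 1, g, s, h => ⟨Fin.cons g s.1, fun i => by
      induction i using Fin.cases with
      | zero => exact h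
      | succ i => exact s.2 i⟩

theorem cons_zero {n : ℕ} (g : G.Arr) (s : G.Strings n) (h : G.src g = G.firstUnit n s) :
    (cons g s h).1 0 = g := by
  cases n <;> rfl

theorem face_zero_cons {n : ℕ} (g : G.Arr) (s : G.Strings n) (h : G.src g = G.firstUnit n s) :
    G.face n 0 (cons g s h) = s := by
  cases n with
  | zero => exact h
  | succ n => rfl

theorem firstUnit_face_zero (n : ℕ) (s : G.Strings (n + 1)) :
    G.firstUnit n (G.face n 0 s) = G.src (s.1 0) := by
  cases n with
  | zero => rfl
  | succ n => exact (s.2 0).symm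

theorem firstUnit_face_succ (n : ℕ) (j : Fin (n + 1)) (s : G.Strings (n + 1)) :
    G.firstUnit n (G.face n j.succ s) = G.firstUnit (n + 1) s := by
  cases n with
  | zero => rfl
  | succ n =>
    change G.rng ((G.face (n + 1) j.succ s).1 0) = G.rng (s.1 0)
    rw [face_succ_apply]
    rcases Nat.eq_zero_or_pos (j : ℕ) with hj | hj
    · rw [if_neg (by simp [hj]), if_pos (by simp [hj])]
      exact G.rng_mul _ _ (s.2 0)
    · rw [if_pos (by simpa using hj)]
      rfl

theorem lastUnit_face_zero (n : ℕ) (s : G.Strings (n + 1)) :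
    G.lastUnit n (G.face n 0 s) = G.lastUnit (n + 1) s := by
  cases n <;> rfl

theorem lastUnit_cons {n : ℕ} (g : G.Arr) (s : G.Strings n) (h : G.src g = G.firstUnit n s) :
    G.lastUnit (n + 1) (cons g s h) = G.lastUnit n s := by
  rw [← lastUnit_face_zero, face_zero_cons]

/-- Reduces each identity for faces of a lengthened string to its first entry and to a simplicial
identity for `d_0`. -/
theorem strings_ext {n : ℕ} {s t : G.Strings (n + 1)} (h0 : s.1 0 = t.1 0)
    (h : G.face n 0 s = G.face n 0 t) : s = t := by
  refine Subtype.ext (funext fun i => ?_)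
  cases n with
  | zero =>
    obtain rfl : i = 0 := Fin.fin_one_eq_zero i
    exact h0
  | succ n =>
    induction i using Fin.cases with
    | zero => exact h0
    | succ i => exact congrFun (congrArg Subtype.val h) i

theorem face_one_cons {n : ℕ} (g : G.Arr) (s : G.Strings (n + 1))
    (h : G.src g = G.firstUnit (n + 1) s) :
    G.face (n + 1) 1 (cons g s h) = cons (G.mul g (s.1 0)) (G.face n 0 s)
      ((G.src_mul _ _ h).trans (firstUnit_face_zero n s).symm) := by
  refine strings_ext ?_ ?_
  · rw [face_succ_apply, cons_zero]
    rfl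
  · rw [face_zero_cons]
    -- This is `d_0 d_1 = d_0 d_0`; the inner `d_0` on the right removes `g`.
    have h1 := G.face_face (n := n) 0 0 le_rfl (cons g s h)
    rw [Fin.succ_zero_eq_one, Fin.castSucc_zero, face_zero_cons] at h1
    exact h1

theorem face_succ_succ_cons {n : ℕ} (j : Fin (n + 1)) (g : G.Arr) (s : G.Strings (n + 1))
    (h : G.src g = G.firstUnit (n + 1) s) :
    G.face (n + 1) j.succ.succ (cons g s h) =
      cons g (G.face n j.succ s) (h.trans (firstUnit_face_succ n j s).symm) := by
  refine strings_ext ?_ ?_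
  · rw [face_succ_apply, cons_zero, if_pos (by simp)]
    exact cons_zero _ _ _
  · rw [face_zero_cons]
    have h1 := G.face_face (n := n) 0 j.succ (Fin.zero_le _) (cons g s h)
    rw [Fin.castSucc_zero, face_zero_cons] at h1
    exact h1

theorem cons_congr {n : ℕ} {g g' : G.Arr} {s s' : G.Strings n} (hg : g = g') (hs : s = s')
    (h : G.src g = G.firstUnit n s) (h' : G.src g' = G.firstUnit n s') :
    cons g s h = cons g' s' h' := by
  subst hg hs
  rfl

theorem continuous_cons {X : Type*} [TopologicalSpace X] {n : ℕ} {γ : X → G.Arr}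
    {σ : X → G.Strings n} (hγ : Continuous γ) (hσ : Continuous σ)
    (h : ∀ x, G.src (γ x) = G.firstUnit n (σ x)) : Continuous fun x => cons (γ x) (σ x) (h x) := by
  cases n with
  | zero => exact Continuous.subtype_mk (continuous_pi fun _ => hγ) _
  | succ n =>
    exact Continuous.subtype_mk (Continuous.finCons hγ (continuous_subtype_val.comp hσ)) _

/-! ### Vanishing of homology in the presence of a translation section -/

variable (G) in
/-- A continuous homomorphism `deg : G → ℤ` with continuous families `sec k x` of arrows starting at
the units `x` which are equivariant: `sec k (r g) g = sec (k + deg g) (s g)`. -/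
structure TranslationSection where
  deg : G.IntHom
  sec : ℤ → G.Obj → G.Arr
  continuous_sec : ∀ k, Continuous (sec k)
  src_sec : ∀ k x, G.src (sec k x) = x
  sec_mul : ∀ k g, G.mul (sec k (G.rng g)) g = sec (k + deg.toFun g) (G.src g)

namespace TranslationSection

variable (S : G.TranslationSection)

/-- The arrow that leads from the range of `sec k x` to the range of `sec (k + 1) x`. -/
def shift (k : ℤ) (x : G.Obj) : G.Arr := G.mul (S.sec (k + 1) x) (G.inv (S.sec k x))

theorem shift_composable (k : ℤ) (x : G.Obj) :
    G.src (S.sec (k + 1) x) = G.rng (G.inv (S.sec k x)) := by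
  rw [S.src_sec, G.rng_inv, S.src_sec]

theorem src_shift (k : ℤ) (x : G.Obj) : G.src (S.shift k x) = G.rng (S.sec k x) := by
  rw [shift, G.src_mul _ _ (S.shift_composable k x), G.src_inv]

theorem continuous_shift (k : ℤ) : Continuous (S.shift k) :=
  G.continuous_mul.comp (Continuous.subtype_mk ((S.continuous_sec (k + 1)).prodMk
    (G.continuous_inv.comp (S.continuous_sec k))) (S.shift_composable k))

theorem shift_mul_sec (k : ℤ) (x : G.Obj) : G.mul (S.shift k x) (S.sec k x) = S.sec (k + 1) x := by
  have h := G.mul_one (S.sec (k + 1) x)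
  rw [shift, G.mul_assoc _ _ _ (S.shift_composable k x) (G.src_inv _), G.inv_mul, S.src_sec]
  rwa [S.src_sec] at h

theorem rng_sec_rng (k : ℤ) (g : G.Arr) :
    G.rng (S.sec k (G.rng g)) = G.rng (S.sec (k + S.deg.toFun g) (G.src g)) := by
  rw [← S.sec_mul, G.rng_mul _ _ (S.src_sec _ _)]

theorem eq_mul_inv {a b c : G.Arr} (hab : G.src a = G.rng b) (h : G.mul a b = c) :
    a = G.mul c (G.inv b) := by
  rw [← h, G.mul_assoc _ _ _ hab (G.rng_inv b).symm, G.mul_inv, ← hab, G.mul_one]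

/-- Multiplying the left side by `sec (k + deg g) (s g) = sec k (r g) g` gives `sec (k + 1) (r g) g
= sec (k + 1 + deg g) (s g)`, and cancelling the factor again gives the right side. Thus `shift` has
the same equivariance as `sec`, except that no factor `g` is needed. -/
theorem shift_rng (k : ℤ) (g : G.Arr) :
    S.shift k (G.rng g) = S.shift (k + S.deg.toFun g) (G.src g) := by
  refine eq_mul_inv ((S.src_shift k _).trans (S.rng_sec_rng k g)) ?_
  rw [← S.sec_mul, ← G.mul_assoc _ _ _ (S.src_shift _ _) (S.src_sec _ _), S.shift_mul_sec,
    S.sec_mul, add_right_comm]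

/-- The map that puts `sec k` in front of a string. -/
def extend (k : ℤ) (n : ℕ) (s : G.Strings n) : G.Strings (n + 1) :=
  cons (S.sec k (G.firstUnit n s)) s (S.src_sec _ _)

theorem firstUnit_extend (k : ℤ) (n : ℕ) (s : G.Strings n) :
    G.firstUnit (n + 1) (S.extend k n s) = G.rng (S.sec k (G.firstUnit n s)) :=
  congrArg G.rng (cons_zero _ _ _)

/-- The map that puts `shift k` and `sec k` in front of a string. -/
def extendTwo (k : ℤ) (n : ℕ) (s : G.Strings n) : G.Strings (n + 2) :=
  cons (S.shift k (G.firstUnit n s)) (S.extend k n s)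
    ((S.src_shift _ _).trans (S.firstUnit_extend k n s).symm)

theorem continuous_extend (k : ℤ) (n : ℕ) : Continuous (S.extend k n) :=
  continuous_cons ((S.continuous_sec k).comp (G.continuous_firstUnit n)) continuous_id _

theorem continuous_extendTwo (k : ℤ) (n : ℕ) : Continuous (S.extendTwo k n) :=
  continuous_cons ((S.continuous_shift k).comp (G.continuous_firstUnit n))
    (S.continuous_extend k n) _

/-- Putting an arrow in front does not change the source of the last entry, so composition with the
local homeomorphism `lastUnit` gives `lastUnit` again. -/
theorem isLocalHomeomorph_extend (k : ℤ) (n : ℕ) : IsLocalHomeomorph (S.extend k n) := by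
  refine IsLocalHomeomorph.of_comp (g := G.lastUnit (n + 1)) ?_ (G.isLocalHomeomorph_lastUnit _)
    (S.continuous_extend k n)
  have h : G.lastUnit (n + 1) ∘ S.extend k n = G.lastUnit n := funext fun s => lastUnit_cons _ _ _
  rw [h]
  exact G.isLocalHomeomorph_lastUnit n

theorem isLocalHomeomorph_extendTwo (k : ℤ) (n : ℕ) : IsLocalHomeomorph (S.extendTwo k n) := by
  refine IsLocalHomeomorph.of_comp (g := G.lastUnit (n + 2)) ?_ (G.isLocalHomeomorph_lastUnit _)
    (S.continuous_extendTwo k n)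
  have h : G.lastUnit (n + 2) ∘ S.extendTwo k n = G.lastUnit n :=
    funext fun s => (lastUnit_cons _ _ _).trans (lastUnit_cons _ _ _)
  rw [h]
  exact G.isLocalHomeomorph_lastUnit n

theorem face_zero_extend (k : ℤ) (n : ℕ) (s : G.Strings n) :
    G.face n 0 (S.extend k n s) = s := face_zero_cons _ _ _

/-- The face `d_1` multiplies `sec k` by the first entry of `s`; equivariance absorbs that entry and
moves the index by its degree. This is the only face whose result depends on the degree. -/
theorem face_one_extend (k : ℤ) (n : ℕ) (s : G.Strings (n + 1)) :
    G.face (n + 1) 1 (S.extend k (n + 1) s) =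
      S.extend (k + S.deg.toFun (s.1 0)) n (G.face n 0 s) := by
  refine (face_one_cons _ _ _).trans (cons_congr ?_ rfl _ _)
  rw [firstUnit_face_zero]
  exact S.sec_mul _ _

theorem face_succ_succ_extend (k : ℤ) (n : ℕ) (j : Fin (n + 1)) (s : G.Strings (n + 1)) :
    G.face (n + 1) j.succ.succ (S.extend k (n + 1) s) = S.extend k n (G.face n j.succ s) := by
  refine (face_succ_succ_cons _ _ _ _).trans (cons_congr ?_ rfl _ _)
  rw [firstUnit_face_succ]

theorem face_zero_extendTwo (k : ℤ) (n : ℕ) (s : G.Strings n) :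
    G.face (n + 1) 0 (S.extendTwo k n s) = S.extend k n s := face_zero_cons _ _ _

theorem face_one_extendTwo (k : ℤ) (n : ℕ) (s : G.Strings n) :
    G.face (n + 1) 1 (S.extendTwo k n s) = S.extend (k + 1) n s := by
  refine (face_one_cons _ _ _).trans (cons_congr ?_ (S.face_zero_extend k n s) _ _)
  rw [extend, cons_zero]
  exact S.shift_mul_sec k _

/-- Here `d_2` merges `sec k` with the first entry of `s`, while `shift k` stays in front;
`shift_rng` re-indexes it by the same degree. -/
theorem face_two_extendTwo (k : ℤ) (n : ℕ) (s : G.Strings (n + 1)) :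
    G.face (n + 2) 2 (S.extendTwo k (n + 1) s) =
      S.extendTwo (k + S.deg.toFun (s.1 0)) n (G.face n 0 s) := by
  refine (face_succ_succ_cons 0 _ _ _).trans (cons_congr ?_ (S.face_one_extend k n s) _ _)
  rw [firstUnit_face_zero]
  exact S.shift_rng k _

theorem face_succ_extendTwo (k : ℤ) (n : ℕ) (j : Fin (n + 1)) (s : G.Strings (n + 1)) :
    G.face (n + 2) j.succ.succ.succ (S.extendTwo k (n + 1) s) =
      S.extendTwo k n (G.face n j.succ s) := by
  refine (face_succ_succ_cons _ _ _ _).trans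
    (cons_congr ?_ (S.face_succ_succ_extend k n j s) _ _)
  rw [firstUnit_face_succ]

end TranslationSection

end EtaleGroupoid

/-! ### The contracting homotopy on chains -/

namespace EtaleGroupoid

variable {G : EtaleGroupoid.{u}}

theorem neg_one_pow_succ_smul {X : Type*} [TopologicalSpace X] (k : ℕ) (f : C_c(X, ℤ)) :
    (-1 : ℤ) ^ (k + 1) • f = -((-1 : ℤ) ^ k • f) := by
  rw [← neg_smul, show (-1 : ℤ) ^ (k + 1) = -(-1) ^ k by ring]

variable (G) in
/-- The map `(d_i)_*` on chains. -/
noncomputable def facePush (n : ℕ) (i : Fin (n + 2)) :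
    C_c(G.Strings (n + 1), ℤ) →+ C_c(G.Strings n, ℤ) :=
  pushforward (G.face n i) (G.isLocalHomeomorph_face n i)

variable (G) in
/-- The part of the boundary map without the summand `(d_0)_*`. -/
noncomputable def boundaryTail (n : ℕ) : C_c(G.Strings (n + 1), ℤ) →+ C_c(G.Strings n, ℤ) :=
  ∑ j : Fin (n + 1), (-1 : ℤ) ^ ((j.succ : Fin (n + 2)) : ℕ) • G.facePush n j.succ

theorem boundary_eq_add_boundaryTail (n : ℕ) (f : C_c(G.Strings (n + 1), ℤ)) :
    G.boundary n f = G.facePush n 0 f + G.boundaryTail n f := by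
  rw [boundary, Fin.sum_univ_succ]
  simp only [Fin.val_zero, pow_zero, one_smul, AddMonoidHom.add_apply]
  rfl

theorem boundaryTail_apply (n : ℕ) (f : C_c(G.Strings (n + 1), ℤ)) :
    G.boundaryTail n f = ∑ j : Fin (n + 1), (-1 : ℤ) ^ ((j : ℕ) + 1) • G.facePush n j.succ f := by
  simp only [boundaryTail, AddMonoidHom.finsetSum_apply, AddMonoidHom.smul_apply, Fin.val_succ]

theorem facePush_facePush {n : ℕ} (i j : Fin (n + 2)) (hij : i ≤ j)
    (f : C_c(G.Strings (n + 2), ℤ)) :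
    G.facePush n i (G.facePush (n + 1) j.succ f) =
      G.facePush n j (G.facePush (n + 1) i.castSucc f) := by
  simp only [facePush, pushforward_comp]
  exact pushforward_congr _ _ fun g _ => G.face_face i j hij g

namespace TranslationSection

variable (S : G.TranslationSection)

/-- The map on chains that puts `sec k` in front of a string. -/
noncomputable def extendPush (k : ℤ) (n : ℕ) : C_c(G.Strings n, ℤ) →+ C_c(G.Strings (n + 1), ℤ) :=
  pushforward (S.extend k n) (S.isLocalHomeomorph_extend k n)

/-- The map on chains that puts `shift k` and `sec k` in front of a string. -/
noncomputable def extendTwoPush (k : ℤ) (n : ℕ) :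
    C_c(G.Strings n, ℤ) →+ C_c(G.Strings (n + 2), ℤ) :=
  pushforward (S.extendTwo k n) (S.isLocalHomeomorph_extendTwo k n)

/-- The degree of the first entry of a string. -/
def firstDeg (n : ℕ) (s : G.Strings (n + 1)) : ℤ := S.deg.toFun (s.1 0)

theorem continuous_firstDeg (n : ℕ) : Continuous (S.firstDeg n) :=
  S.deg.continuous_toFun.comp ((continuous_apply 0).comp continuous_subtype_val)

/-- The face `d_0` returns `f`, and `d_1` gives the term with index `k + m`, where `m` must be
constant on the support. The other faces are those of `f` with the index raised by one, which
reverses the sign of the tail. -/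
theorem boundary_extendPush {n : ℕ} {f : C_c(G.Strings (n + 1), ℤ)} {m : ℤ}
    (hf : ∀ s, f s ≠ 0 → S.firstDeg n s = m) (k : ℤ) :
    G.boundary (n + 1) (S.extendPush k (n + 1) f) =
      f - S.extendPush (k + m) n (G.facePush n 0 f) - S.extendPush k n (G.boundaryTail n f) := by
  have h0 : G.facePush (n + 1) 0 (S.extendPush k (n + 1) f) = f := by
    simp only [facePush, extendPush, pushforward_comp]
    exact pushforward_of_forall_eq _ (S.face_zero_extend k (n + 1)) f
  have h1 : G.facePush (n + 1) 1 (S.extendPush k (n + 1) f) =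
      S.extendPush (k + m) n (G.facePush n 0 f) := by
    simp only [facePush, extendPush, pushforward_comp]
    exact pushforward_congr _ _ fun s hs => by
      have := S.face_one_extend k n s
      rwa [← hf s hs]
  have h2 : ∀ j : Fin (n + 1), G.facePush (n + 1) j.succ.succ (S.extendPush k (n + 1) f) =
      S.extendPush k n (G.facePush n j.succ f) := fun j => by
    simp only [facePush, extendPush, pushforward_comp]
    exact pushforward_congr _ _ fun s _ => S.face_succ_succ_extend k n j s
  rw [boundary_eq_add_boundaryTail, boundaryTail_apply, Fin.sum_univ_succ, h0, Fin.succ_zero_eq_one,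
    h1, boundaryTail_apply, map_sum]
  simp only [h2, map_neg, map_zsmul, Fin.val_zero, Fin.val_succ, neg_one_pow_succ_smul, pow_zero,
    one_smul, neg_neg, Finset.sum_neg_distrib]
  abel

/-- The faces `d_0` and `d_1` produce the two prefixes with indices `k` and `k + 1`, so this
operator interpolates between consecutive values of `extendPush`. The faces of `f` itself appear
with the index raised by two and keep their signs. -/
theorem boundary_extendTwoPush {n : ℕ} {f : C_c(G.Strings (n + 1), ℤ)} {m : ℤ}
    (hf : ∀ s, f s ≠ 0 → S.firstDeg n s = m) (k : ℤ) :
    G.boundary (n + 2) (S.extendTwoPush k (n + 1) f) =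
      (S.extendPush k (n + 1) f - S.extendPush (k + 1) (n + 1) f) +
        S.extendTwoPush (k + m) n (G.facePush n 0 f) +
          S.extendTwoPush k n (G.boundaryTail n f) := by
  have h0 : G.facePush (n + 2) 0 (S.extendTwoPush k (n + 1) f) = S.extendPush k (n + 1) f := by
    simp only [facePush, extendPush, extendTwoPush, pushforward_comp]
    exact pushforward_congr _ _ fun s _ => S.face_zero_extendTwo k (n + 1) s
  have h1 : G.facePush (n + 2) 1 (S.extendTwoPush k (n + 1) f) =
      S.extendPush (k + 1) (n + 1) f := by
    simp only [facePush, extendPush, extendTwoPush, pushforward_comp]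
    exact pushforward_congr _ _ fun s _ => S.face_one_extendTwo k (n + 1) s
  have h2 : G.facePush (n + 2) 2 (S.extendTwoPush k (n + 1) f) =
      S.extendTwoPush (k + m) n (G.facePush n 0 f) := by
    simp only [facePush, extendTwoPush, pushforward_comp]
    exact pushforward_congr _ _ fun s hs => by
      have := S.face_two_extendTwo k n s
      rwa [← hf s hs]
  have h3 : ∀ j : Fin (n + 1), G.facePush (n + 2) j.succ.succ.succ (S.extendTwoPush k (n + 1) f) =
      S.extendTwoPush k n (G.facePush n j.succ f) := fun j => by
    simp only [facePush, extendTwoPush, pushforward_comp]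
    exact pushforward_congr _ _ fun s _ => S.face_succ_extendTwo k n j s
  rw [boundary_eq_add_boundaryTail, boundaryTail_apply, Fin.sum_univ_succ, Fin.sum_univ_succ, h0,
    Fin.succ_zero_eq_one, h1, show (Fin.succ (Fin.succ 0) : Fin (n + 4)) = 2 from rfl,
    h2, boundaryTail_apply, map_sum]
  simp only [h3, map_neg, map_zsmul, Fin.val_zero, Fin.val_succ, neg_one_pow_succ_smul, pow_zero,
    one_smul, neg_neg, Finset.sum_neg_distrib]
  abel

/-- The part of the contracting homotopy that deals with strings whose first entry has
degree `m`. -/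
noncomputable def homotopyPart (n : ℕ) (m : ℤ) :
    C_c(G.Strings (n + 1), ℤ) →+ C_c(G.Strings (n + 2), ℤ) :=
  -- By `boundary_extendPush`, the first term alone leaves `extendPush m` of the face `d_0` where
  -- `extendPush 0` is wanted. The signed sum telescopes from `0` to `m` and replaces one by the
  -- other.
  S.extendPush 0 (n + 1) -
    (signedSum (fun k => S.extendTwoPush k n) m).comp (G.facePush n 0)

theorem homotopyPart_apply (n : ℕ) (m : ℤ) (f : C_c(G.Strings (n + 1), ℤ)) :
    S.homotopyPart n m f = S.extendPush 0 (n + 1) f -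
      signedSum (fun k => S.extendTwoPush k n (G.facePush n 0 f)) m := by
  rw [homotopyPart, AddMonoidHom.sub_apply, AddMonoidHom.comp_apply, signedSum_apply]

/-- A contracting homotopy on chains for which the degree of the first entries is at most `N`. -/
noncomputable def homotopy (N : ℤ) (n : ℕ) :
    C_c(G.Strings (n + 1), ℤ) →+ C_c(G.Strings (n + 2), ℤ) :=
  ∑ m ∈ Finset.Icc (-N) N,
    (S.homotopyPart n m).comp (fiberRestrict (S.firstDeg n) (S.continuous_firstDeg n) m)

/-- On a chain of a single first degree only the summand with that degree survives, so the cutoff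
has no influence once it is large enough. -/
theorem homotopy_apply {N : ℤ} {n : ℕ} {m : ℤ} (hm : |m| ≤ N) {f : C_c(G.Strings (n + 1), ℤ)}
    (hf : ∀ s, f s ≠ 0 → S.firstDeg n s = m) : S.homotopy N n f = S.homotopyPart n m f := by
  rw [homotopy, AddMonoidHom.finsetSum_apply, Finset.sum_eq_single m]
  · rw [AddMonoidHom.comp_apply, fiberRestrict_eq_self _ hf]
  · intro m' _ hm'
    rw [AddMonoidHom.comp_apply, fiberRestrict_eq_zero _ hm'.symm hf, map_zero]
  · exact fun h => absurd (Finset.mem_Icc.2 (abs_le.1 hm)) h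

theorem firstDeg_face_one (n : ℕ) (s : G.Strings (n + 2)) :
    S.firstDeg n (G.face (n + 1) 1 s) = S.firstDeg (n + 1) s + S.deg.toFun (s.1 1) := by
  rw [firstDeg, face_succ_apply]
  exact S.deg.map_mul _ _ (s.2 0)

theorem firstDeg_face_succ_succ (n : ℕ) (j : Fin (n + 1)) (s : G.Strings (n + 2)) :
    S.firstDeg n (G.face (n + 1) j.succ.succ s) = S.firstDeg (n + 1) s := by
  rw [firstDeg, face_succ_apply, if_pos (by simp)]
  rfl

/-- Fixing the degrees of the first two entries fixes the first degree of every face: `m₂` for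
`d_0`, `m₁ + m₂` for `d_1`, and `m₁` for the rest. The `extendPush` terms cancel by telescoping. The
`extendTwoPush` terms on `d_0 d_0 f` cancel because the sum up to `m₁ + m₂` splits into the sum up
to `m₂` and a shifted sum of length `m₁`. A second entry is needed, hence strings of length at least
two. -/
theorem boundary_homotopy_add_of_deg {N : ℤ} {n : ℕ} {m₁ m₂ : ℤ} (h1 : |m₁| ≤ N) (h2 : |m₂| ≤ N)
    (h12 : |m₁ + m₂| ≤ N) {f : C_c(G.Strings (n + 2), ℤ)}
    (hf₁ : ∀ s, f s ≠ 0 → S.firstDeg (n + 1) s = m₁)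
    (hf₂ : ∀ s, f s ≠ 0 → S.deg.toFun (s.1 1) = m₂) :
    G.boundary (n + 2) (S.homotopy N (n + 1) f) +
      S.homotopy N n (G.boundary (n + 1) f) = f := by
  have hd0 : ∀ s, G.facePush (n + 1) 0 f s ≠ 0 → S.firstDeg n s = m₂ := fun s hs => by
    obtain ⟨t, rfl, ht⟩ := exists_of_pushforward_ne_zero _ hs
    exact hf₂ t ht
  have hd1 : ∀ s, G.facePush (n + 1) 1 f s ≠ 0 → S.firstDeg n s = m₁ + m₂ := fun s hs => by
    obtain ⟨t, rfl, ht⟩ := exists_of_pushforward_ne_zero _ hs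
    rw [firstDeg_face_one, hf₁ t ht, hf₂ t ht]
  have hd2 : ∀ (j : Fin (n + 1)) s, G.facePush (n + 1) j.succ.succ f s ≠ 0 →
      S.firstDeg n s = m₁ := fun j s hs => by
    obtain ⟨t, rfl, ht⟩ := exists_of_pushforward_ne_zero _ hs
    rw [firstDeg_face_succ_succ, hf₁ t ht]
  -- The signed sums for `d_0 f` and `d_1 f` thus run over the same chain `d_0 d_0 f` and can be
  -- compared.
  have hc1 : G.facePush n 0 (G.facePush (n + 1) 1 f) =
      G.facePush n 0 (G.facePush (n + 1) 0 f) := facePush_facePush 0 0 le_rfl f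
  have hc2 : ∀ j : Fin (n + 1), G.facePush n 0 (G.facePush (n + 1) j.succ.succ f) =
      G.facePush n j.succ (G.facePush (n + 1) 0 f) := fun j =>
    facePush_facePush 0 j.succ (Fin.zero_le _) f
  -- the boundary map, split into the faces with first entries of different degrees
  have hb : G.boundary (n + 1) f = G.facePush (n + 1) 0 f - G.facePush (n + 1) 1 f +
      ∑ j : Fin (n + 1), (-1 : ℤ) ^ (j : ℕ) • G.facePush (n + 1) j.succ.succ f := by
    rw [boundary_eq_add_boundaryTail, boundaryTail_apply, Fin.sum_univ_succ]
    simp only [Fin.val_zero, Fin.val_succ, neg_one_pow_succ_smul, pow_zero, one_smul, neg_neg,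
      Fin.succ_zero_eq_one]
    abel
  have ht : G.boundaryTail (n + 1) f = - G.facePush (n + 1) 1 f +
      ∑ j : Fin (n + 1), (-1 : ℤ) ^ (j : ℕ) • G.facePush (n + 1) j.succ.succ f := by
    have := boundary_eq_add_boundaryTail (n + 1) f
    rw [hb] at this
    rw [← add_right_inj (G.facePush (n + 1) 0 f), ← this]
    abel
  -- All faces from `d_2` on have first degree `m₁`, so the single map `homotopyPart n m₁` applies
  -- to their signed sum; its `d_0` is the negative of the tail of the boundary of `d_0 f`.
  have hE : ∑ j : Fin (n + 1), (-1 : ℤ) ^ (j : ℕ) •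
      S.homotopy N n (G.facePush (n + 1) j.succ.succ f) =
      S.extendPush 0 (n + 1)
        (∑ j : Fin (n + 1), (-1 : ℤ) ^ (j : ℕ) • G.facePush (n + 1) j.succ.succ f) +
      signedSum (fun k => S.extendTwoPush k n
        (G.boundaryTail n (G.facePush (n + 1) 0 f))) m₁ := by
    have hsum : G.facePush n 0
        (∑ j : Fin (n + 1), (-1 : ℤ) ^ (j : ℕ) • G.facePush (n + 1) j.succ.succ f) =
        - G.boundaryTail n (G.facePush (n + 1) 0 f) := by
      simp only [map_sum, map_zsmul, hc2, boundaryTail_apply, neg_one_pow_succ_smul,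
        Finset.sum_neg_distrib, neg_neg]
    have hpart : ∀ j : Fin (n + 1), S.homotopy N n (G.facePush (n + 1) j.succ.succ f) =
        S.homotopyPart n m₁ (G.facePush (n + 1) j.succ.succ f) := fun j =>
      S.homotopy_apply h1 (hd2 j)
    have hout : ∑ j : Fin (n + 1), (-1 : ℤ) ^ (j : ℕ) •
        S.homotopyPart n m₁ (G.facePush (n + 1) j.succ.succ f) = S.homotopyPart n m₁
          (∑ j : Fin (n + 1), (-1 : ℤ) ^ (j : ℕ) • G.facePush (n + 1) j.succ.succ f) := by
      simp only [map_sum, map_zsmul]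
    simp only [hpart]
    rw [hout, homotopyPart_apply, hsum]
    simp only [map_neg, signedSum, Finset.sum_neg_distrib]
    abel
  rw [hb, map_add, map_sub, map_sum, S.homotopy_apply h1 hf₁, S.homotopy_apply h2 hd0,
    S.homotopy_apply h12 hd1]
  simp only [map_zsmul]
  rw [hE]
  simp only [homotopyPart_apply, hc1, map_sub, map_signedSum]
  rw [S.boundary_extendPush hf₁, ht]
  simp only [S.boundary_extendTwoPush hd0, signedSum_add]
  rw [signedSum_shift (fun k => S.extendTwoPush k n (G.facePush n 0 (G.facePush (n + 1) 0 f))),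
    signedSum_sub_succ (fun k => S.extendPush k (n + 1) (G.facePush (n + 1) 0 f))]
  simp only [map_add, map_neg, zero_add]
  abel

/-- By linearity `f` may be cut into pieces on which the first two degrees are constant. The cutoff
`2 * N` leaves room for the product formed by `d_1`, whose degree is the sum of two degrees bounded
by `N`. -/
theorem boundary_homotopy_add {N : ℤ} {n : ℕ} {f : C_c(G.Strings (n + 2), ℤ)}
    (hf₁ : ∀ s, f s ≠ 0 → |S.firstDeg (n + 1) s| ≤ N)
    (hf₂ : ∀ s, f s ≠ 0 → |S.deg.toFun (s.1 1)| ≤ N) :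
    G.boundary (n + 2) (S.homotopy (2 * N) (n + 1) f) +
      S.homotopy (2 * N) n (G.boundary (n + 1) f) = f := by
  have hp₂ : Continuous fun s : G.Strings (n + 2) => S.deg.toFun (s.1 1) :=
    S.deg.continuous_toFun.comp ((continuous_apply 1).comp continuous_subtype_val)
  have hsum : f = ∑ m₁ ∈ Finset.Icc (-N) N, ∑ m₂ ∈ Finset.Icc (-N) N,
      fiberRestrict (S.firstDeg (n + 1)) (S.continuous_firstDeg (n + 1)) m₁
        (fiberRestrict _ hp₂ m₂ f) := by
    simp only [← map_sum]
    rw [sum_fiberRestrict hp₂ fun s hs => Finset.mem_Icc.2 (abs_le.1 (hf₂ s hs)),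
      sum_fiberRestrict _ fun s hs => Finset.mem_Icc.2 (abs_le.1 (hf₁ s hs))]
  rw [hsum]
  simp only [map_sum, ← Finset.sum_add_distrib]
  refine Finset.sum_congr rfl fun m₁ hm₁ => Finset.sum_congr rfl fun m₂ hm₂ => ?_
  rw [Finset.mem_Icc] at hm₁ hm₂
  refine S.boundary_homotopy_add_of_deg (m₁ := m₁) (m₂ := m₂) (abs_le.2 ⟨by omega, by omega⟩)
    (abs_le.2 ⟨by omega, by omega⟩) (abs_le.2 ⟨by omega, by omega⟩) (fun s hs => ?_) fun s hs => ?_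
  · by_contra h
    exact hs (by rw [fiberRestrict_apply, if_neg h])
  · by_contra h
    refine hs ?_
    rw [fiberRestrict_apply, fiberRestrict_apply, if_neg h, ite_self]

/-- In degrees at least two, every cycle of a groupoid with a translation section is a
boundary. -/
theorem exists_boundary_eq (S : G.TranslationSection) {n : ℕ} {f : C_c(G.Strings (n + 2), ℤ)}
    (hf : G.boundary (n + 1) f = 0) : ∃ f', G.boundary (n + 2) f' = f := by
  have hp₂ : Continuous fun s : G.Strings (n + 2) => S.deg.toFun (s.1 1) :=
    S.deg.continuous_toFun.comp ((continuous_apply 1).comp continuous_subtype_val)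
  obtain ⟨N₁, h₁⟩ := exists_abs_le (S.continuous_firstDeg (n + 1)) f
  obtain ⟨N₂, h₂⟩ := exists_abs_le hp₂ f
  have h := S.boundary_homotopy_add (N := max N₁ N₂) (fun s hs => (h₁ s hs).trans (le_max_left _ _))
    fun s hs => (h₂ s hs).trans (le_max_right _ _)
  -- For a cycle the second term of the homotopy identity vanishes, and the first exhibits `f` as a
  -- boundary.
  rw [hf, map_zero, add_zero] at h
  exact ⟨_, h⟩

end TranslationSection

end EtaleGroupoid

namespace EtaleGroupoid

variable {G : EtaleGroupoid.{u}}

/-! ### Open subgroupoids -/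

variable (G) in
/-- An open subgroupoid with the same units as `G`. -/
structure OpenSubgroupoid where
  carrier : Set G.Arr
  isOpen_carrier : IsOpen carrier
  one_mem : ∀ x, G.one x ∈ carrier
  inv_mem : ∀ g ∈ carrier, G.inv g ∈ carrier
  mul_mem : ∀ g ∈ carrier, ∀ h ∈ carrier, G.src g = G.rng h → G.mul g h ∈ carrier

namespace OpenSubgroupoid

variable (S : G.OpenSubgroupoid)

open scoped Classical in
/-- The product of `G` restricted to an open subgroupoid; the value on pairs that are not composable
is irrelevant. -/
noncomputable def subMul (g h : S.carrier) : S.carrier :=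
  if hgh : G.src g.1 = G.rng h.1 then ⟨G.mul g.1 h.1, S.mul_mem _ g.2 _ h.2 hgh⟩ else g

theorem subMul_val (g h : S.carrier) (hgh : G.src g.1 = G.rng h.1) :
    (S.subMul g h).1 = G.mul g.1 h.1 := by
  rw [subMul, dif_pos hgh]

theorem isLocalHomeomorph_val : IsLocalHomeomorph (Subtype.val : S.carrier → G.Arr) :=
  S.isOpen_carrier.isOpenEmbedding_subtypeVal.isLocalHomeomorph

theorem continuous_subMul :
    Continuous fun p : {p : S.carrier × S.carrier // G.src p.1.1 = G.rng p.2.1} =>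
      S.subMul p.1.1 p.1.2 := by
  refine Topology.IsInducing.subtypeVal.continuous_iff.2 ?_
  have h : Continuous fun p : {p : S.carrier × S.carrier // G.src p.1.1 = G.rng p.2.1} =>
      (⟨(p.1.1.1, p.1.2.1), p.2⟩ : {p : G.Arr × G.Arr // G.src p.1 = G.rng p.2}) := by fun_prop
  exact (G.continuous_mul.comp h).congr fun p => (S.subMul_val _ _ p.2).symm

/-- An open subgroupoid as an étale groupoid. -/
noncomputable def toGroupoid : EtaleGroupoid.{u} where
  Obj := G.Obj
  Arr := S.carrier
  src g := G.src g.1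
  rng g := G.rng g.1
  one x := ⟨G.one x, S.one_mem x⟩
  inv g := ⟨G.inv g.1, S.inv_mem _ g.2⟩
  mul := S.subMul
  src_one x := G.src_one x
  rng_one x := G.rng_one x
  src_inv g := G.src_inv g.1
  rng_inv g := G.rng_inv g.1
  src_mul g h hgh := by rw [S.subMul_val _ _ hgh, G.src_mul _ _ hgh]
  rng_mul g h hgh := by rw [S.subMul_val _ _ hgh, G.rng_mul _ _ hgh]
  mul_assoc g h k hgh hhk := by
    have h1 : G.src (S.subMul g h).1 = G.rng k.1 := by
      rw [S.subMul_val _ _ hgh, G.src_mul _ _ hgh, hhk]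
    have h2 : G.src g.1 = G.rng (S.subMul h k).1 := by
      rw [S.subMul_val _ _ hhk, G.rng_mul _ _ hhk, hgh]
    apply Subtype.ext
    rw [S.subMul_val _ _ h1, S.subMul_val _ _ h2, S.subMul_val _ _ hgh, S.subMul_val _ _ hhk,
      G.mul_assoc _ _ _ hgh hhk]
  one_mul g := Subtype.ext ((S.subMul_val _ _ (G.src_one _)).trans (G.one_mul g.1))
  mul_one g := Subtype.ext ((S.subMul_val _ _ (G.rng_one _).symm).trans (G.mul_one g.1))
  inv_mul g := Subtype.ext ((S.subMul_val _ _ (G.src_inv _)).trans (G.inv_mul g.1))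
  mul_inv g := Subtype.ext ((S.subMul_val _ _ (G.rng_inv _).symm).trans (G.mul_inv g.1))
  continuous_one := G.continuous_one.subtype_mk _
  continuous_inv := (G.continuous_inv.comp continuous_subtype_val).subtype_mk _
  continuous_mul := S.continuous_subMul
  isLocalHomeomorph_src := G.isLocalHomeomorph_src.comp S.isLocalHomeomorph_val
  isLocalHomeomorph_rng := G.isLocalHomeomorph_rng.comp S.isLocalHomeomorph_val

/-- The inclusion of the strings of an open subgroupoid. -/
def incl : (n : ℕ) → S.toGroupoid.Strings n → G.Strings n
  | 0, x => x
  | _ + 1, s => ⟨fun i => (s.1 i).1, fun i => s.2 i⟩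

theorem continuous_incl (n : ℕ) : Continuous (S.incl n) := by
  cases n with
  | zero => exact continuous_id
  | succ n =>
    have h : ∀ i, Continuous fun s : S.toGroupoid.Strings (n + 1) => s.1 i := fun i =>
      (continuous_apply i).comp continuous_subtype_val
    exact Continuous.subtype_mk (continuous_pi fun i =>
      S.isLocalHomeomorph_val.continuous.comp (h i)) _

theorem lastUnit_incl (n : ℕ) (s : S.toGroupoid.Strings n) :
    G.lastUnit n (S.incl n s) = S.toGroupoid.lastUnit n s := by
  cases n <;> rfl

theorem isLocalHomeomorph_incl (n : ℕ) : IsLocalHomeomorph (S.incl n) := by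
  refine IsLocalHomeomorph.of_comp (g := G.lastUnit n) ?_ (G.isLocalHomeomorph_lastUnit n)
    (S.continuous_incl n)
  have h : G.lastUnit n ∘ S.incl n = S.toGroupoid.lastUnit n := funext (S.lastUnit_incl n)
  rw [h]
  exact S.toGroupoid.isLocalHomeomorph_lastUnit n

theorem incl_injective (n : ℕ) : Function.Injective (S.incl n) := by
  cases n with
  | zero => exact Function.injective_id
  | succ n =>
    intro s t h
    refine Subtype.ext (funext fun i => Subtype.ext ?_)
    exact congrFun (congrArg Subtype.val h) i

theorem face_incl (n : ℕ) (i : Fin (n + 2)) (s : S.toGroupoid.Strings (n + 1)) :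
    G.face n i (S.incl (n + 1) s) = S.incl n (S.toGroupoid.face n i s) := by
  cases n with
  | zero => fin_cases i <;> rfl
  | succ n =>
    refine Subtype.ext (funext fun k => ?_)
    change _ = ((S.toGroupoid.face (n + 1) i s).1 k).1
    rw [face_succ_apply, face_succ_apply]
    split_ifs
    · rfl
    · exact (S.subMul_val _ _ (s.2 k)).symm
    · rfl

/-- The inclusion of the chains of an open subgroupoid. -/
noncomputable def inclPush (n : ℕ) : C_c(S.toGroupoid.Strings n, ℤ) →+ C_c(G.Strings n, ℤ) :=
  pushforward (S.incl n) (S.isLocalHomeomorph_incl n)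

theorem boundary_inclPush (n : ℕ) (f : C_c(S.toGroupoid.Strings (n + 1), ℤ)) :
    G.boundary n (S.inclPush (n + 1) f) = S.inclPush n (S.toGroupoid.boundary n f) := by
  simp only [boundary, inclPush, AddMonoidHom.finsetSum_apply, AddMonoidHom.smul_apply, map_sum,
    map_zsmul, pushforward_comp]
  refine Finset.sum_congr rfl fun i _ => ?_
  congr 1
  exact pushforward_congr _ _ fun s _ => S.face_incl n i s

/-- The inclusion of strings is an open embedding whose range contains the support of `f`, so
restricting `f` to the subgroupoid keeps the support compact, and extension by zero gives `f` back.
-/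
theorem exists_inclPush_eq {n : ℕ} {f : C_c(G.Strings (n + 1), ℤ)}
    (hf : ∀ s, f s ≠ 0 → ∀ i, s.1 i ∈ S.carrier) : ∃ f', S.inclPush (n + 1) f' = f := by
  have hemb := (S.isLocalHomeomorph_incl (n + 1)).isOpenEmbedding_of_injective (S.incl_injective _)
  have hrange : ∀ s, f s ≠ 0 → s ∈ Set.range (S.incl (n + 1)) := fun s hs =>
    ⟨⟨fun i => ⟨s.1 i, hf s hs i⟩, fun i => s.2 i⟩, rfl⟩
  -- Since `ℤ` is discrete, the support is already closed. Hence the compact set `tsupport f` lies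
  -- in the range too, not merely the set where `f` is nonzero.
  have hclosed : IsClosed (Function.support f) :=
    (isClosed_discrete ({0}ᶜ : Set ℤ)).preimage f.continuous
  have hcomp : IsCompact (Function.support f) := by
    have h := f.hasCompactSupport.isCompact
    rwa [tsupport, hclosed.closure_eq] at h
  let f' : C_c(S.toGroupoid.Strings (n + 1), ℤ) :=
    { toFun := fun s => f (S.incl (n + 1) s)
      continuous_toFun := f.continuous.comp (S.continuous_incl _)
      hasCompactSupport' := HasCompactSupport.intro
        (hemb.isInducing.isCompact_preimage' hcomp hrange) fun s hs => by
          by_contra h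
          exact hs h }
  refine ⟨f', ?_⟩
  ext s
  by_cases hs : f s = 0
  · rw [hs]
    by_contra h
    obtain ⟨t, rfl, ht⟩ := exists_of_pushforward_ne_zero _ h
    exact ht hs
  · obtain ⟨t, rfl⟩ := hrange s hs
    exact pushforward_apply_of_injective _ (S.incl_injective _) f' t

end OpenSubgroupoid

/-! ### Homology of an increasing union of open subgroupoids -/

/-- A string has finitely many entries, so it lies in one member of the union. The strings of the
members form an increasing open cover, and compactness of the support selects one of them. -/
theorem exists_forall_mem_carrier {S : ℕ → G.OpenSubgroupoid}
    (hmono : Monotone fun N => (S N).carrier) (hcover : ∀ g, ∃ N, g ∈ (S N).carrier) {n : ℕ}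
    (f : C_c(G.Strings (n + 1), ℤ)) : ∃ N, ∀ s, f s ≠ 0 → ∀ i, s.1 i ∈ (S N).carrier := by
  let U : ℕ → Set (G.Strings (n + 1)) := fun N => {s | ∀ i, s.1 i ∈ (S N).carrier}
  have hU : ∀ N, IsOpen (U N) := fun N => by
    simp only [U, Set.ofPred_forall]
    exact isOpen_iInter_of_finite fun i =>
      (S N).isOpen_carrier.preimage ((continuous_apply i).comp continuous_subtype_val)
  have hUm : Monotone U := fun M N h s hs i => hmono h (hs i)
  obtain ⟨N, hN⟩ := f.hasCompactSupport.isCompact.elim_directed_cover U hU (fun s _ => by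
    choose N hN using fun i => hcover (s.1 i)
    exact Set.mem_iUnion.2 ⟨Finset.univ.sup N, fun i =>
      hmono (Finset.le_sup (Finset.mem_univ i)) (hN i)⟩) hUm.directed_le
  exact ⟨N, fun s hs => hN (subset_tsupport f hs)⟩

theorem subsingleton_homology_of_forall_cycle {n : ℕ}
    (h : ∀ f, G.boundary n f = 0 → ∃ f', G.boundary (n + 1) f' = f) :
    Subsingleton (G.Homology (n + 1)) := by
  have htop : (G.boundary (n + 1)).range.addSubgroupOf (G.cycles (n + 1)) = ⊤ :=
    AddSubgroup.addSubgroupOf_eq_top.2 fun f hf => h f hf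
  rw [Homology, htop]
  exact QuotientAddGroup.subsingleton_quotient_top

/-- The homology in degrees at least two of an increasing union of open subgroupoids with
translation sections vanishes. -/
theorem subsingleton_homology_of_translationSection {S : ℕ → G.OpenSubgroupoid}
    (hmono : Monotone fun N => (S N).carrier) (hcover : ∀ g, ∃ N, g ∈ (S N).carrier)
    (hS : ∀ N, Nonempty (S N).toGroupoid.TranslationSection) {i : ℕ} (hi : 2 ≤ i) :
    Subsingleton (G.Homology i) := by
  obtain ⟨n, rfl⟩ := Nat.exists_eq_add_of_le' hi
  refine subsingleton_homology_of_forall_cycle fun f hf => ?_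
  obtain ⟨N, hN⟩ := exists_forall_mem_carrier hmono hcover f
  obtain ⟨f, rfl⟩ := (S N).exists_inclPush_eq hN
  rw [OpenSubgroupoid.boundary_inclPush] at hf
  -- Injectivity of the inclusion on chains makes the preimage of a cycle a cycle of the
  -- subgroupoid.
  have hf' : (S N).toGroupoid.boundary (n + 1) f = 0 :=
    pushforward_injective _ ((S N).incl_injective _) (hf.trans (map_zero _).symm)
  obtain ⟨f', rfl⟩ := (hS N).some.exists_boundary_eq hf'
  exact ⟨(S N).inclPush _ f', (S N).boundary_inclPush _ f'⟩

end EtaleGroupoid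

/-! ### The filtration of the kernel groupoid by the length of paths -/

namespace Katsura

variable {V : Type u} {A B : Matrix V V ℤ}

theorem exists_mem_cylinder (x : InfPath A) (N : ℕ) :
    ∃ β : FinPath A, β.length = N ∧ x ∈ cylinder β := by
  induction N with
  | zero => exact ⟨.vertex x.src, rfl, x, rfl, rfl⟩
  | succ N ih =>
    obtain ⟨β, rfl, hx⟩ := ih
    exact ⟨_, β.length_snoc _ _, mem_cylinder_snoc hx (src_drop_of_mem hx)⟩

/-- The path formed by the first `N` edges of `x`. -/
noncomputable def InfPath.take (N : ℕ) (x : InfPath A) : FinPath A :=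
  (exists_mem_cylinder x N).choose

theorem InfPath.length_take (N : ℕ) (x : InfPath A) : (InfPath.take N x).length = N :=
  (exists_mem_cylinder x N).choose_spec.1

theorem InfPath.mem_cylinder_take (N : ℕ) (x : InfPath A) : x ∈ cylinder (InfPath.take N x) :=
  (exists_mem_cylinder x N).choose_spec.2

theorem InfPath.take_eq {N : ℕ} {x : InfPath A} {β : FinPath A} (hx : x ∈ cylinder β)
    (hβ : β.length = N) : InfPath.take N x = β :=
  eq_of_mem_cylinder (InfPath.mem_cylinder_take N x) hx ((InfPath.length_take N x).trans hβ.symm)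

open scoped Classical in
/-- A path of length `|β|` that ends where `β` ends and depends only on `|β|` and `r(β)`. -/
noncomputable def standardPath (β : FinPath A) : FinPath A :=
  -- The condition always holds, as `β` itself is a witness; the choice sees `β` only through its
  -- length and range.
  if h : ∃ μ : FinPath A, μ.length = β.length ∧ μ.rng = β.rng then h.choose else β

theorem standardPath_spec (β : FinPath A) :
    (standardPath β).length = β.length ∧ (standardPath β).rng = β.rng := by
  have h : ∃ μ : FinPath A, μ.length = β.length ∧ μ.rng = β.rng := ⟨β, rfl, rfl⟩
  rw [standardPath, dif_pos h]
  exact h.choose_spec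

theorem standardPath_congr {β β' : FinPath A} (hl : β.length = β'.length) (hr : β.rng = β'.rng) :
    standardPath β = standardPath β' := by
  have h : ∃ μ : FinPath A, μ.length = β.length ∧ μ.rng = β.rng := ⟨β, rfl, rfl⟩
  have h' : ∃ μ : FinPath A, μ.length = β'.length ∧ μ.rng = β'.rng := ⟨β', rfl, rfl⟩
  rw [standardPath, standardPath, dif_pos h, dif_pos h']
  simp only [hl, hr]

/-- Equivalent quadruples agree after prolongation, by equally many edges if the lengths of `β`
agree. Pseudo freeness makes prolongation injective, so it can be undone. Hence a class has at most
one representative with a given length of `β`. -/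
theorem eq_of_mk_eq (hAB : PseudoFree A B) {q q' : Quad A} (h : mk B q = mk B q')
    (hβ : q.β.length = q'.β.length) : q = q' := by
  obtain ⟨a, b, hab⟩ := (mk_eq_iff B q q').1 h
  have h1 := congrArg (fun r => r.β.length) hab
  simp only [Quad.iterate_length_β, hβ] at h1
  obtain rfl : a = b := by omega
  exact (Quad.next_injective hAB).iterate a hab

/-! ### Arrows of a fixed level, their integer degree and the section -/

namespace Arrow

/-- The arrow has the form `[α, m, β; x]` with `|α| = |β| = N`. -/
def IsLevel (N : ℕ) (g : Arrow A B) : Prop :=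
  ∃ q : Quad A, q.α.length = N ∧ q.β.length = N ∧ mk B q = g

theorem isLevel_one (N : ℕ) (x : InfPath A) : IsLevel N (one x : Arrow A B) :=
  ⟨⟨InfPath.take N x, 0, InfPath.take N x, x, rfl, InfPath.mem_cylinder_take N x⟩,
    InfPath.length_take N x, InfPath.length_take N x, mk_eq_one rfl rfl⟩

theorem IsLevel.inv {N : ℕ} {g : Arrow A B} (hg : IsLevel N g) : IsLevel N g.inv := by
  obtain ⟨q, h1, h2, rfl⟩ := hg
  exact ⟨q.inv B, h2, h1, rfl⟩

/-- The common infinite path extends both `q.β` and `q'.α`, and equal lengths force these to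
coincide. At a fixed level, representatives can therefore be multiplied without prolongation. -/
theorem matched_of_length {q q' : Quad A} (h : q.β.length = q'.α.length)
    (hx : (mk B q).src = (mk B q').rng) : q.Matched B q' :=
  have hx' : q.x = q'.rng B := hx
  ⟨eq_of_mem_cylinder q.mem (hx' ▸ q'.rng_mem B) h, hx'⟩

theorem IsLevel.mul {N : ℕ} {g h : Arrow A B} (hg : IsLevel N g) (hh : IsLevel N h)
    (hgh : g.src = h.rng) : IsLevel N (mul g h) := by
  obtain ⟨q, h1, h2, rfl⟩ := hg
  obtain ⟨q', h1', h2', rfl⟩ := hh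
  have hm := matched_of_length (h2.trans h1'.symm) hgh
  exact ⟨q.comp q' hm.1, h1, h2', (mul_mk hm).symm⟩

theorem isOpen_isLevel (N : ℕ) : IsOpen {g : Arrow A B | IsLevel N g} := by
  refine isOpen_iff_forall_mem_open.2 ?_
  rintro _ ⟨q, h1, h2, rfl⟩
  refine ⟨nbhd B q, ?_, isOpen_nbhd q, mem_nbhd q⟩
  rintro _ ⟨p, h3, -, h4, rfl⟩
  exact ⟨p, by rw [h3, h1], by rw [h4, h2], rfl⟩

theorem IsLevel.succ {N : ℕ} {g : Arrow A B} (hg : IsLevel N g) : IsLevel (N + 1) g := by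
  obtain ⟨q, h1, h2, rfl⟩ := hg
  exact ⟨q.next B, by rw [Quad.next_length_α, h1], by rw [Quad.next_length_β, h2], mk_next B q⟩

theorem exists_isLevel {g : Arrow A B} (hg : g.degree = 0) : ∃ N, IsLevel N g := by
  induction g using Quot.ind with | mk q => ?_
  have h : (q.α.length : ℤ) - q.β.length = 0 := hg
  exact ⟨q.β.length, q, by omega, rfl, rfl⟩

open scoped Classical in
/-- The number `m` for an arrow `[α, m, β; x]` with `|α| = |β| = N`. -/
noncomputable def levelDeg (N : ℕ) (g : Arrow A B) : ℤ :=
  -- Off level `N` the value `0` is arbitrary; on level `N` the choice is unique by `eq_of_mk_eq`.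
  if h : IsLevel N g then h.choose.m else 0

theorem levelDeg_mk (hAB : PseudoFree A B) {N : ℕ} {q : Quad A} (h1 : q.α.length = N)
    (h2 : q.β.length = N) : levelDeg N (mk B q) = q.m := by
  have h : IsLevel N (mk B q) := ⟨q, h1, h2, rfl⟩
  rw [levelDeg, dif_pos h]
  obtain ⟨-, h4, h5⟩ := h.choose_spec
  rw [eq_of_mk_eq hAB h5 (h4.trans h2.symm)]

theorem levelDeg_mul (hAB : PseudoFree A B) {N : ℕ} {g h : Arrow A B} (hg : IsLevel N g)
    (hh : IsLevel N h) (hgh : g.src = h.rng) :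
    levelDeg N (mul g h) = levelDeg N g + levelDeg N h := by
  obtain ⟨q, h1, h2, rfl⟩ := hg
  obtain ⟨q', h1', h2', rfl⟩ := hh
  have hm := matched_of_length (h2.trans h1'.symm) hgh
  rw [mul_mk hm, levelDeg_mk hAB h1 h2, levelDeg_mk hAB h1' h2',
    levelDeg_mk hAB (q := q.comp q' hm.1) h1 h2']
  rfl

theorem eventually_levelDeg_eq (hAB : PseudoFree A B) {N : ℕ} {g : Arrow A B} (hg : IsLevel N g) :
    ∀ᶠ h in nhds g, levelDeg N h = levelDeg N g := by
  obtain ⟨q, h1, h2, rfl⟩ := hg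
  filter_upwards [(isOpen_nbhd (B := B) q).mem_nhds (mem_nbhd q)]
  rintro _ ⟨p, h3, h4, h5, rfl⟩
  rw [levelDeg_mk hAB h1 h2, levelDeg_mk hAB (by rw [h3, h1]) (by rw [h5, h2]), h4]

/-- The quadruple `(μ, k, β; x)` where `β` consists of the first `N` edges of `x` and `μ` is the
standard path of length `N` that ends where `β` ends. -/
noncomputable def sectionQuad (N : ℕ) (k : ℤ) (x : InfPath A) : Quad A where
  α := standardPath (InfPath.take N x)
  m := k
  β := InfPath.take N x
  x := x
  rng_eq := (standardPath_spec _).2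
  mem := InfPath.mem_cylinder_take N x

variable (B) in
/-- The class of `sectionQuad`. -/
noncomputable def levelSection (N : ℕ) (k : ℤ) (x : InfPath A) : Arrow A B :=
  mk B (sectionQuad N k x)

theorem length_sectionQuad_α (N : ℕ) (k : ℤ) (x : InfPath A) :
    (sectionQuad N k x).α.length = N :=
  (standardPath_spec _).1.trans (InfPath.length_take N x)

theorem length_sectionQuad_β (N : ℕ) (k : ℤ) (x : InfPath A) :
    (sectionQuad N k x).β.length = N := InfPath.length_take N x

theorem isLevel_levelSection (N : ℕ) (k : ℤ) (x : InfPath A) :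
    IsLevel N (levelSection B N k x) :=
  ⟨_, length_sectionQuad_α N k x, length_sectionQuad_β N k x, rfl⟩

theorem degree_levelSection (N : ℕ) (k : ℤ) (x : InfPath A) :
    (levelSection B N k x).degree = 0 := by
  change ((sectionQuad N k x).α.length : ℤ) - (sectionQuad N k x).β.length = 0
  rw [length_sectionQuad_α, length_sectionQuad_β, sub_self]

/-- Near `x` the first `N` edges are constant, hence so are the standard path and the entries `α`,
`m`, `β`; the section locally inverts the source map on a basic open set. -/
theorem continuous_levelSection (N : ℕ) (k : ℤ) :
    Continuous (levelSection B N k : InfPath A → Arrow A B) := by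
  refine ⟨fun U hU => isOpen_iff_forall_mem_open.2 fun x hx => ?_⟩
  let O := nbhd B (sectionQuad N k x)
  have hO : IsOpen O := isOpen_nbhd _
  refine ⟨src '' (U ∩ O), ?_, isOpenMap_src _ (hU.inter hO), levelSection B N k x,
    ⟨hx, mem_nbhd _⟩, rfl⟩
  rintro _ ⟨_, ⟨hgU, ⟨p, h1, h2, h3, rfl⟩⟩, rfl⟩
  have h4 : InfPath.take N p.x = p.β :=
    InfPath.take_eq p.mem ((congrArg FinPath.length h3).trans (length_sectionQuad_β N k x))
  have h5 : InfPath.take N p.x = InfPath.take N x := h4.trans h3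
  -- The point `p` has the entries `α`, `m`, `β` of the section at `x`, and these are also the
  -- entries of the section at `p.x`.
  have h6 : sectionQuad N k p.x = p := by
    refine Quad.ext ?_ h2.symm h4 rfl
    rw [h1]
    exact congrArg standardPath h5
  change mk B (sectionQuad N k p.x) ∈ U
  rwa [h6]

/-- For `g = [α, m, β; x]` the product is `[μ, k, α; r(g)] [α, m, β; x] = [μ, k + m, β; x]`. The
standard path for `α` is also the one for `β`, since `r(α) = r(β)` and the lengths agree; this is
why `standardPath` must not depend on anything else. -/
theorem levelSection_mul (hAB : PseudoFree A B) {N : ℕ} (k : ℤ) {g : Arrow A B}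
    (hg : IsLevel N g) :
    mul (levelSection B N k g.rng) g = levelSection B N (k + levelDeg N g) g.src := by
  obtain ⟨q, h1, h2, rfl⟩ := hg
  have hm : (sectionQuad N k (q.rng B)).Matched B q :=
    matched_of_length ((length_sectionQuad_β N k _).trans h1.symm) rfl
  refine (mul_mk hm).trans (congrArg (mk B) ?_)
  have h3 : InfPath.take N q.x = q.β := InfPath.take_eq q.mem h2
  rw [levelDeg_mk hAB h1 h2]
  refine Quad.ext ?_ rfl h3.symm rfl
  refine standardPath_congr ?_ ?_
  · rw [InfPath.length_take]
    exact (InfPath.length_take N _).symm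
  · change (sectionQuad N k (q.rng B)).β.rng = (InfPath.take N q.x).rng
    rw [hm.1, q.rng_eq, h3]

end Arrow

/-! ### The levels as open subgroupoids with translation sections -/

open EtaleGroupoid

/-- The open subgroupoid of the arrows `[α, m, β; x]` with `|α| = |β| = N`. -/
noncomputable def levelSubgroupoid (hAB : PseudoFree A B) (N : ℕ) :
    (kernelGroupoid hAB).OpenSubgroupoid where
  carrier := {g : {g : Arrow A B // g.degree = 0} | g.1.IsLevel N}
  isOpen_carrier := (Arrow.isOpen_isLevel N).preimage
    (rho hAB).isLocalHomeomorph_kerVal.continuous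
  one_mem x := Arrow.isLevel_one N x
  inv_mem _ hg := Arrow.IsLevel.inv hg
  mul_mem g hg h hh hgh := by
    have h1 := (rho hAB).kerMul_val g h hgh
    change Arrow.IsLevel N ((rho hAB).kerMul g h).1
    rw [h1]
    exact Arrow.IsLevel.mul hg hh hgh

theorem levelSubgroupoid_val_mul (hAB : PseudoFree A B) (N : ℕ)
    (g h : (levelSubgroupoid hAB N).carrier)
    (hgh : Arrow.src g.1.1 = Arrow.rng h.1.1) :
    ((levelSubgroupoid hAB N).subMul g h).1.1 = Arrow.mul g.1.1 h.1.1 := by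
  rw [(levelSubgroupoid hAB N).subMul_val g h hgh]
  exact (rho hAB).kerMul_val g.1 h.1 hgh

/-- The translation section of the groupoid of the arrows `[α, m, β; x]` with `|α| = |β| = N`. -/
noncomputable def levelTranslationSection (hAB : PseudoFree A B) (N : ℕ) :
    (levelSubgroupoid hAB N).toGroupoid.TranslationSection where
  deg :=
    { toFun := fun g => Arrow.levelDeg N g.1.1
      map_mul := fun g h hgh => by
        have h1 := levelSubgroupoid_val_mul hAB N g h hgh
        exact (congrArg (Arrow.levelDeg N) h1).trans (Arrow.levelDeg_mul hAB g.2 h.2 hgh)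
      continuous_toFun := by
        refine continuous_iff_continuousAt.2 fun g => ?_
        have hval : Continuous fun h : (levelSubgroupoid hAB N).toGroupoid.Arr => h.1.1 :=
          (rho hAB).isLocalHomeomorph_kerVal.continuous.comp
            (levelSubgroupoid hAB N).isLocalHomeomorph_val.continuous
        refine (continuousAt_const (y := Arrow.levelDeg N g.1.1)).congr ?_
        filter_upwards [hval.continuousAt.eventually (Arrow.eventually_levelDeg_eq hAB g.2)]
          with h hh using hh.symm }
  sec k x := ⟨⟨Arrow.levelSection B N k x, Arrow.degree_levelSection (B := B) N k x⟩,
    Arrow.isLevel_levelSection (B := B) N k x⟩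
  continuous_sec k := ((Arrow.continuous_levelSection N k).subtype_mk _).subtype_mk _
  src_sec _ _ := rfl
  sec_mul k g := by
    refine Subtype.ext (Subtype.ext ?_)
    exact (levelSubgroupoid_val_mul hAB N _ g rfl).trans (Arrow.levelSection_mul hAB k g.2)

end Katsura

theorem mainTheorem6 {V : Type*} [Countable V] (A B : Matrix V V ℤ)
    (hA_nonneg : ∀ i j, 0 ≤ A i j)
    (hA_rowFinite : Katsura.RowFinite A) (hB_rowFinite : Katsura.RowFinite B)
    (hA_rows : ∀ i, ∃ j, A i j ≠ 0) (hB_rows : ∀ i, ∃ j, B i j ≠ 0)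
    (hAB : Katsura.PseudoFree A B) (i : ℕ) (hi : 2 ≤ i) :
    Subsingleton ((Katsura.kernelGroupoid hAB).Homology i) := by
  refine EtaleGroupoid.subsingleton_homology_of_translationSection
    (S := Katsura.levelSubgroupoid hAB) ?_ ?_
    (fun N => ⟨Katsura.levelTranslationSection hAB N⟩) hi
  -- Prolonging a representative by one edge raises its level by one.
  · exact monotone_nat_of_le_succ fun N g hg => Katsura.Arrow.IsLevel.succ hg
  -- Degree zero means `|α| = |β|`, so every arrow of the kernel has a level.
  · exact fun g => Katsura.Arrow.exists_isLevel g.2
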